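/- **Conventions.** Write $e(z)=e^{2\pi i z}$, $\widehat f(\xi)=\int_{\mathbb R^n} f(x)\,e(-x\cdot\xi)\,dx$ and $e^{it\Delta}f(x)=\int_{\mathbb R^n}\widehat f(\xi)\,e(x\cdot\xi+t|\xi|^2)\,d\xi$. Balls $B^d(a,r)\subset\mathbb R^d$ are closed and Euclidean. Let $1\le m\le n-1$ and write each $x\in\mathbb R^n$ (and each $p\in\mathbb Z^n$) as $x=(x_1,x',x'')\in\mathbb R\times\mathbb R^{n-m-1}\times\mathbb R^m$. **Datum.** Let $\phi\in\mathcal S(\mathbb R)$, $\varphi_1\in\mathcal S(\mathbb R^{n-m-1})$, $\varphi_2\in\mathcal S(\mathbb R^m)$ be nonzero Schwartz functions whose Fourier transforms are nonnegative and supported in $B(0,c_0)$, and let $\psi\in\mathcal S(\mathbb R^{n-m-1})$ be a nonnegative, not identically zero cutoff supported in $B(0,c_0)$. For $0<c\le c_0$ and parameters $R,D_1,D_2$ put $f_R(x)=g(x_1)h_1(x')h_2(x'')$, where $$\widehat g(\xi_1)=\widehat\phi\Big(\frac{\xi_1-R}{R^{1/2}}\Big),\qquad \widehat{h_1}(\xi')=\sum_{\ell'\in\mathbb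 Z^{n-m-1}}\psi\Big(\frac{\ell'}{R/D_1}\Big)\widehat\varphi_1(\xi'-D_1\ell'),\qquad \widehat{h_2}(\xi'')=\sum_{\ell''\in\mathbb Z^m,\ |\ell''|\le cR^{1/2}/D_2}\widehat\varphi_2(\xi''-D_2\ell'').$$ For $q\in\mathbb N$ and $p\in\mathbb Z^n$ let $$E_R(p,q)=B^1\Big(-\frac{2R}{D_1^2}\frac{p_1}{q},\frac1{R^{1/2}}\Big)\times B^{n-m-1}\Big(\frac{p'}{D_1q},\frac1R\Big)\times B^m\Big(\frac{p''}{D_2},\frac1{R^{1/2}}\Big).$$ **Proposition.** For all $1\le m\le n-1$ there is $c_0>0$ such that for every $c\in(0,c_0]$ and all $\phi,\varphi_1,\varphi_2,\psi$ as above there are constants $C_0,C>0$ (depending only on $n,m,c,\phi,\varphi_1,\varphi_2,\psi$) with the following property. Let $R\ge C_0$, $D_1\ge1$, $1\le D_2\le R^{1/2}$, $Q\in\mathbb R$ and, if $m<n-1$, $R\ge C_0D_1Q$. Let $q$ be an odd natural number with $Q/2\le q<Q$, let $p\in\mathbb Z^n$ with $\gcd(p_1,q)=1$, and put $t=p_1/(D_1^2q)$.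 Let $x\in E_R(p,q)$. 1. If $|t|\le 1/R$, $|x'|\le1$ and $|x''|\le 1$, then $$C^{-1}M\le\frac{|e^{it\Delta}f_R(x)|}{\|f_R\|_2}\le C\,M,\qquad M=R^{1/4}\Big(\frac{R}{D_1Q}\Big)^{(n-m-1)/2}\Big(\frac{R^{1/2}}{D_2}\Big)^{m/2}.$$ 2. If $1/10\le|x_1|\le1$, then $C^{-1}R^{-1}\le|t|\le C\,R^{-1}$. (If $R\ge1$, the condition $|t|\le1/R$ in part 1 holds for every $x\in E_R(p,q)$ with $|x_1|\le1$, so part 1 covers all of $E_R(p,q)\cap B^n(0,1)$.) -/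

import Mathlib

open scoped FourierTransform SchwartzMap

noncomputable section

namespace TalbotDatum

/-- The character `e(z) = exp (2 π i z)`. -/
def e (z : ℝ) : ℂ := Complex.exp (2 * Real.pi * z * Complex.I)

/-! The splitting `v = (v₁, v', v'')` of an `n`-tuple into blocks of lengths `1`, `n - m - 1`
and `m`. -/

/-- The first entry `v₁`. -/
def firstPart {α : Type} {n m : ℕ} (h : m < n) (v : Fin n → α) : α := v ⟨0, by omega⟩

/-- The middle block `v'`, consisting of entries number `2, …, n - m`. -/
def middlePart {α : Type} {n m : ℕ} (_h : m < n) (v : Fin n → α) : Fin (n - m - 1) → α :=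
  fun i => v ⟨1 + i, by omega⟩

/-- The last block `v''`, consisting of the last `m` entries. -/
def lastPart {α : Type} {n m : ℕ} (_h : m < n) (v : Fin n → α) : Fin m → α :=
  fun i => v ⟨n - m + i, by omega⟩

/-- The integer vector `ℓ` as a point of Euclidean space. -/
def latticePoint {d : ℕ} (l : Fin d → ℤ) : EuclideanSpace ℝ (Fin d) :=
  WithLp.toLp 2 fun i => (l i : ℝ)

/-- The Schrödinger evolution
`e^{itΔ} f (x) = ∫ 𝓕 f (ξ) e(x ⬝ ξ + t |ξ|²) dξ`, where `𝓕 f (ξ) = ∫ f (x) e(- x ⬝ ξ) dx`. -/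
def evolution {n : ℕ} (t : ℝ) (f : EuclideanSpace ℝ (Fin n) → ℂ)
    (x : EuclideanSpace ℝ (Fin n)) : ℂ :=
  ∫ ξ : EuclideanSpace ℝ (Fin n), 𝓕 f ξ * e (inner ℝ x ξ + t * ‖ξ‖ ^ 2)

/-- The `L²` norm with respect to Lebesgue measure. -/
def normL2 {n : ℕ} (f : EuclideanSpace ℝ (Fin n) → ℂ) : ℝ :=
  (MeasureTheory.eLpNorm f 2 MeasureTheory.volume).toReal

/-- A nonzero Schwartz function whose Fourier transform is nonnegative and supported in the
closed ball `B(0, r)`. -/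
structure IsFourierBump {E : Type} [NormedAddCommGroup E] [InnerProductSpace ℝ E]
    [FiniteDimensional ℝ E] [MeasurableSpace E] [BorelSpace E] (r : ℝ) (φ : 𝓢(E, ℂ)) : Prop where
  ne_zero : φ ≠ 0
  fourier_re_nonneg : ∀ ξ : E, 0 ≤ (𝓕 (φ : E → ℂ) ξ).re
  fourier_im_eq_zero : ∀ ξ : E, (𝓕 (φ : E → ℂ) ξ).im = 0
  fourier_support : ∀ ξ : E, r < ‖ξ‖ → 𝓕 (φ : E → ℂ) ξ = 0

/-- A smooth cutoff: nonnegative, not identically zero, supported in the closed ball `B(0, r)`. -/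
structure IsCutoff {d : ℕ} (r : ℝ) (ψ : 𝓢(EuclideanSpace ℝ (Fin d), ℝ)) : Prop where
  ne_zero : ψ ≠ 0
  nonneg : ∀ y, 0 ≤ ψ y
  support : ∀ y, r < ‖y‖ → ψ y = 0

/-- The function `g` with Fourier transform `𝓕 φ ((ξ₁ - R) / R^{1/2})`. -/
def datumFirst (φ : 𝓢(ℝ, ℂ)) (R : ℝ) : ℝ → ℂ :=
  𝓕⁻ fun ξ : ℝ => 𝓕 (φ : ℝ → ℂ) ((ξ - R) / √R)

/-- The function `h₁` with Fourier transform
`∑_{ℓ'} ψ(ℓ' / (R / D₁)) 𝓕 φ₁ (ξ' - D₁ ℓ')`, the sum running over `ℤ^d`. -/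
def datumMiddle {d : ℕ} (φ₁ : 𝓢(EuclideanSpace ℝ (Fin d), ℂ))
    (ψ : 𝓢(EuclideanSpace ℝ (Fin d), ℝ)) (R D₁ : ℝ) : EuclideanSpace ℝ (Fin d) → ℂ :=
  𝓕⁻ fun ξ : EuclideanSpace ℝ (Fin d) =>
    ∑' l : Fin d → ℤ, (ψ ((R / D₁)⁻¹ • latticePoint l) : ℂ) *
      𝓕 (φ₁ : EuclideanSpace ℝ (Fin d) → ℂ) (ξ - D₁ • latticePoint l)

/-- The function `h₂` with Fourier transform `∑_{ℓ''} 𝓕 φ₂ (ξ'' - D₂ ℓ'')`, the sum running over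
the `ℓ'' ∈ ℤ^m` with `|ℓ''| ≤ c R^{1/2} / D₂`. -/
def datumLast {m : ℕ} (φ₂ : 𝓢(EuclideanSpace ℝ (Fin m), ℂ)) (c R D₂ : ℝ) :
    EuclideanSpace ℝ (Fin m) → ℂ :=
  𝓕⁻ fun ξ : EuclideanSpace ℝ (Fin m) =>
    ∑' l : {l : Fin m → ℤ // ‖latticePoint l‖ ≤ c * √R / D₂},
      𝓕 (φ₂ : EuclideanSpace ℝ (Fin m) → ℂ) (ξ - D₂ • latticePoint l.1)

/-- The datum `f_R (x) = g (x₁) h₁ (x') h₂ (x'')`. -/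
def datum {n m : ℕ} (h : m < n) (φ : 𝓢(ℝ, ℂ))
    (φ₁ : 𝓢(EuclideanSpace ℝ (Fin (n - m - 1)), ℂ)) (φ₂ : 𝓢(EuclideanSpace ℝ (Fin m), ℂ))
    (ψ : 𝓢(EuclideanSpace ℝ (Fin (n - m - 1)), ℝ)) (c R D₁ D₂ : ℝ) :
    EuclideanSpace ℝ (Fin n) → ℂ :=
  fun x => datumFirst φ R (firstPart h x.ofLp) *
    datumMiddle φ₁ ψ R D₁ (WithLp.toLp 2 (middlePart h x.ofLp)) *
    datumLast φ₂ c R D₂ (WithLp.toLp 2 (lastPart h x.ofLp))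

/-- The time `t = p₁ / (D₁² q)`. -/
def time {n m : ℕ} (h : m < n) (D₁ : ℝ) (p : Fin n → ℤ) (q : ℕ) : ℝ :=
  ((firstPart h p : ℤ) : ℝ) / (D₁ ^ 2 * q)

/-- The slab `E_R(p, q)`, the product of the closed balls
`B(-2 R p₁ / (D₁² q), R^{-1/2})`, `B(p' / (D₁ q), R⁻¹)` and `B(p'' / D₂, R^{-1/2})`.
The first centre is `-2 R t`, the position at time `t = p₁ / (D₁² q)` of a wave packet of frequency
`R` under the phase `e(x ⬝ ξ + t |ξ|²)`. -/
def slab {n m : ℕ} (h : m < n) (R D₁ D₂ : ℝ) (p : Fin n → ℤ) (q : ℕ) :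
    Set (EuclideanSpace ℝ (Fin n)) :=
  {x | |firstPart h x.ofLp - -2 * (R / D₁ ^ 2) * (((firstPart h p : ℤ) : ℝ) / q)| ≤ 1 / √R ∧
    ‖WithLp.toLp 2 (middlePart h x.ofLp) - (D₁ * q)⁻¹ • latticePoint (middlePart h p)‖ ≤ 1 / R ∧
    ‖WithLp.toLp 2 (lastPart h x.ofLp) - D₂⁻¹ • latticePoint (lastPart h p)‖ ≤ 1 / √R}

end TalbotDatum

end

/-!
The datum is a tensor product over the three blocks of variables. By Fubini's theorem so is its
evolution (`evolution_tensor`), and by Plancherel's theorem its norm is the product of the norms of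
the blocks (`normL2_tensor`). Each block is treated on the Fourier side, as a phase integral
`∫ H(ξ) e(x ⬝ ξ + t |ξ|²) dξ` with an explicit `H ≥ 0`, and the three factors `R^{1/4}`,
`(R / (D₁ Q))^{(n - m - 1) / 2}` and `(R^{1/2} / D₂)^{m / 2}` are the sizes of the ratios of these
integrals to `‖H‖₂`.

In the first block, `x₁` is within `R^{-1/2}` of the position `-2 R t` of a wave packet of
frequency `R`, so that after rescaling the phase hardly varies on the support of `H`; there is no
cancellation (`half_integral_le_re`), and the ratio has the size `R^{1/2} / R^{1/4}`
(`sameSize_first`). In the last block `x''` is close to `D₂⁻¹ ℤ^m`, the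
frequencies `D₂ l` are at most `c √R`, and the phases of all the bumps are close to integers; the
ratio is the square root of the number of bumps (`sameSize_last`).

The middle block carries the arithmetic. At time `t = p₁ / (D₁² q)` and near `p' / (D₁ q)` the bump
at `D₁ l` has the phase `(p' ⬝ l + p₁ |l|²) / q`, and the block is an average of sums
`∑ ψ(δ l) e(w ⬝ δ l) e((p' ⬝ l + p₁ |l|²) / q)` with `δ = D₁ / R` and bounded `w`
(`phaseIntegral_middleFourier`). Such a sum is the product of the mean values of the quadratic
phases, each of modulus `q^{-1/2}` (`norm_inv_mul_quadGauss`), and the sum without arithmetic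
factor, up to a relative error `O((q δ)²)` which is small as soon as `R ≥ C₀ D₁ Q`
(`exists_bound_latticeSum`).

To prove this, `ψ` is multiplied by a product of one-dimensional cutoffs, which does not change it,
and expanded into characters by Fourier inversion; the sum becomes a superposition of products of
one-dimensional sums (`sum_lattice_eq_integral`). In one dimension the quadratic phase is expanded
into characters modulo `q`, all of whose coefficients have modulus `q^{-1/2}`. The trivial
character gives the main term. For the character `e(v l / q)` two summations by parts gain
`δ² / |e(v / q) - 1|²`, and these gains are summable over `v ≠ 0` with sum `O((q δ)²)`
(`norm_quadratic_tsum_sub_le`, `exists_bound_quadratic_modulated`).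
-/

open MeasureTheory

namespace TalbotDatum

/-! ### The character -/

lemma e_add (a b : ℝ) : e (a + b) = e a * e b := by
  simp only [e]
  rw [← Complex.exp_add]
  congr 1
  push_cast
  ring

lemma norm_e (a : ℝ) : ‖e a‖ = 1 := by
  have h : (2 * Real.pi * a * Complex.I : ℂ) = ((2 * Real.pi * a : ℝ) : ℂ) * Complex.I := by
    push_cast
    ring
  rw [e, h, Complex.norm_exp_ofReal_mul_I]

@[fun_prop]
lemma continuous_e : Continuous e := by
  unfold e
  fun_prop

lemma e_intCast (k : ℤ) : e k = 1 := by
  rw [e, Complex.exp_eq_one_iff]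
  exact ⟨k, by push_cast; ring⟩

lemma fourier_eq_integral_e {E : Type} [NormedAddCommGroup E] [InnerProductSpace ℝ E]
    [FiniteDimensional ℝ E] [MeasurableSpace E] [BorelSpace E] (f : E → ℂ) (ξ : E) :
    𝓕 f ξ = ∫ x, f x * e (-inner ℝ x ξ) := by
  rw [Real.fourier_eq']
  refine integral_congr_ae (.of_forall fun x => ?_)
  simp only [e, smul_eq_mul]
  rw [mul_comm]
  congr 2
  push_cast
  ring

lemma fourierInv_eq_integral_e {E : Type} [NormedAddCommGroup E] [InnerProductSpace ℝ E]
    [FiniteDimensional ℝ E] [MeasurableSpace E] [BorelSpace E] (f : E → ℂ) (x : E) :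
    𝓕⁻ f x = ∫ ξ, f ξ * e (inner ℝ ξ x) := by
  rw [Real.fourierInv_eq']
  refine integral_congr_ae (.of_forall fun ξ => ?_)
  simp only [e, smul_eq_mul]
  rw [mul_comm]
  congr 2
  push_cast
  ring

/-! ### Splitting the space into the three blocks -/

/-- The positions `1, …, n`, grouped into the three blocks. -/
def blockEquiv {n m : ℕ} (h : m < n) : Fin 1 ⊕ (Fin (n - m - 1) ⊕ Fin m) ≃ Fin n :=
  (Equiv.sumCongr (Equiv.refl _) finSumFinEquiv).trans
    (finSumFinEquiv.trans (finCongr (by omega)))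

/-- The splitting `x ↦ (x₁, x', x'')` as a measurable equivalence. -/
def splitEquiv {n m : ℕ} (h : m < n) :
    EuclideanSpace ℝ (Fin n) ≃ᵐ
      ℝ × EuclideanSpace ℝ (Fin (n - m - 1)) × EuclideanSpace ℝ (Fin m) :=
  (((MeasurableEquiv.toLp 2 (Fin n → ℝ)).symm.trans
    (MeasurableEquiv.piCongrLeft (fun _ => ℝ) (blockEquiv h)).symm).trans
    (MeasurableEquiv.sumPiEquivProdPi fun _ => ℝ)).trans
    ((MeasurableEquiv.funUnique (Fin 1) ℝ).prodCongr
      ((MeasurableEquiv.sumPiEquivProdPi fun _ => ℝ).trans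
        ((MeasurableEquiv.toLp 2 _).prodCongr (MeasurableEquiv.toLp 2 _))))

lemma splitEquiv_apply {n m : ℕ} (h : m < n) (x : EuclideanSpace ℝ (Fin n)) :
    splitEquiv h x = (firstPart h x.ofLp, WithLp.toLp 2 (middlePart h x.ofLp),
      WithLp.toLp 2 (lastPart h x.ofLp)) := by
  have hl (i : Fin m) : 1 + (n - m - 1 + (i : ℕ)) = n - m + i := by omega
  refine Prod.ext ?_ (Prod.ext ?_ ?_)
  · rfl
  · rfl
  · refine congrArg (WithLp.toLp 2) (funext fun i => ?_)
    change x.ofLp _ = x.ofLp _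
    exact congrArg x.ofLp (Fin.ext (hl i))

lemma measurePreserving_splitEquiv {n m : ℕ} (h : m < n) :
    MeasurePreserving (splitEquiv h) := by
  refine MeasurePreserving.trans (MeasurePreserving.trans (MeasurePreserving.trans
    (EuclideanSpace.volume_preserving_symm_measurableEquiv_toLp (Fin n))
    (volume_measurePreserving_piCongrLeft (fun _ => ℝ) (blockEquiv h)).symm)
    (volume_measurePreserving_sumPiEquivProdPi fun _ => ℝ))
    (MeasurePreserving.prod (volume_preserving_funUnique (Fin 1) ℝ) 
      (MeasurePreserving.trans (volume_measurePreserving_sumPiEquivProdPi fun _ => ℝ)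
        (MeasurePreserving.prod (PiLp.volume_preserving_toLp _) (PiLp.volume_preserving_toLp _))))

lemma sum_eq_split {n m : ℕ} (h : m < n) (f : Fin n → ℝ) :
    ∑ i, f i = firstPart h f + ∑ i, middlePart h f i + ∑ i, lastPart h f i := by
  have hl (i : Fin m) : 1 + (n - m - 1 + (i : ℕ)) = n - m + i := by omega
  rw [← (blockEquiv h).sum_comp, Fintype.sum_sum_type, Fintype.sum_sum_type, Fin.sum_univ_one,
    add_assoc]
  congr 2
  refine Finset.sum_congr rfl fun i _ => ?_
  change f _ = f _
  congr 1
  ext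
  exact hl i

lemma inner_eq_split {n m : ℕ} (h : m < n) (x y : EuclideanSpace ℝ (Fin n)) :
    inner ℝ x y = inner ℝ (firstPart h x.ofLp) (firstPart h y.ofLp) +
      inner ℝ (WithLp.toLp 2 (middlePart h x.ofLp)) (WithLp.toLp 2 (middlePart h y.ofLp)) +
      inner ℝ (WithLp.toLp 2 (lastPart h x.ofLp)) (WithLp.toLp 2 (lastPart h y.ofLp)) := by
  simp only [PiLp.inner_apply]
  rw [sum_eq_split h]
  rfl

lemma norm_sq_eq_split {n m : ℕ} (h : m < n) (x : EuclideanSpace ℝ (Fin n)) :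
    ‖x‖ ^ 2 = ‖firstPart h x.ofLp‖ ^ 2 + ‖WithLp.toLp 2 (middlePart h x.ofLp)‖ ^ 2 +
      ‖WithLp.toLp 2 (lastPart h x.ofLp)‖ ^ 2 := by
  simp only [← real_inner_self_eq_norm_sq]
  exact inner_eq_split h x x

/-- The tensor product `x ↦ f₁(x₁) f₂(x') f₃(x'')`. -/
def tensor {n m : ℕ} (h : m < n) (f₁ : ℝ → ℂ) (f₂ : EuclideanSpace ℝ (Fin (n - m - 1)) → ℂ)
    (f₃ : EuclideanSpace ℝ (Fin m) → ℂ) : EuclideanSpace ℝ (Fin n) → ℂ :=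
  fun x => f₁ (firstPart h x.ofLp) * f₂ (WithLp.toLp 2 (middlePart h x.ofLp)) *
    f₃ (WithLp.toLp 2 (lastPart h x.ofLp))

lemma tensor_eq_comp {n m : ℕ} (h : m < n) (f₁ : ℝ → ℂ)
    (f₂ : EuclideanSpace ℝ (Fin (n - m - 1)) → ℂ) (f₃ : EuclideanSpace ℝ (Fin m) → ℂ) :
    tensor h f₁ f₂ f₃ = (fun z => f₁ z.1 * (f₂ z.2.1 * f₃ z.2.2)) ∘ splitEquiv h := by
  ext x
  simp [tensor, splitEquiv_apply, mul_assoc]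

lemma integral_tensor {n m : ℕ} (h : m < n) (f₁ : ℝ → ℂ)
    (f₂ : EuclideanSpace ℝ (Fin (n - m - 1)) → ℂ) (f₃ : EuclideanSpace ℝ (Fin m) → ℂ) :
    ∫ x, tensor h f₁ f₂ f₃ x = (∫ x, f₁ x) * (∫ x, f₂ x) * ∫ x, f₃ x := by
  rw [tensor_eq_comp]
  simp only [Function.comp_apply]
  rw [(measurePreserving_splitEquiv h).integral_comp (splitEquiv h).measurableEmbedding
    (fun z : ℝ × EuclideanSpace ℝ (Fin (n - m - 1)) × EuclideanSpace ℝ (Fin m) =>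
      f₁ z.1 * (f₂ z.2.1 * f₃ z.2.2))]
  change ∫ z : ℝ × EuclideanSpace ℝ (Fin (n - m - 1)) × EuclideanSpace ℝ (Fin m),
    f₁ z.1 * (f₂ z.2.1 * f₃ z.2.2) ∂(volume.prod volume) = _
  rw [integral_prod_mul f₁ fun z : EuclideanSpace ℝ (Fin (n - m - 1)) × _ => f₂ z.1 * f₃ z.2,
    mul_assoc]
  congr 1
  exact integral_prod_mul f₂ f₃

lemma fourier_tensor {n m : ℕ} (h : m < n) (f₁ : ℝ → ℂ)
    (f₂ : EuclideanSpace ℝ (Fin (n - m - 1)) → ℂ) (f₃ : EuclideanSpace ℝ (Fin m) → ℂ) :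
    𝓕 (tensor h f₁ f₂ f₃) = tensor h (𝓕 f₁) (𝓕 f₂) (𝓕 f₃) := by
  ext ξ
  rw [tensor]
  simp only [fourier_eq_integral_e]
  rw [← integral_tensor h]
  refine integral_congr_ae (.of_forall fun x => ?_)
  simp only [tensor]
  rw [inner_eq_split h, neg_add, neg_add, e_add, e_add]
  ring

/-- The phase integral `∫ H(ξ) e(x ⬝ ξ + t |ξ|²) dξ`: the Schrödinger evolution of the function with
Fourier transform `H`. -/
noncomputable def phaseIntegral {E : Type} [NormedAddCommGroup E] [InnerProductSpace ℝ E]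
    [MeasurableSpace E] [BorelSpace E] [FiniteDimensional ℝ E] (t : ℝ) (H : E → ℂ) (x : E) : ℂ :=
  ∫ ξ, H ξ * e (inner ℝ x ξ + t * ‖ξ‖ ^ 2)

/-- The square `∫ |H|²` of the `L²` norm. -/
noncomputable def normSq {E : Type} [NormedAddCommGroup E] [InnerProductSpace ℝ E]
    [MeasurableSpace E] [BorelSpace E] [FiniteDimensional ℝ E] (H : E → ℂ) : ℝ :=
  ∫ ξ, ‖H ξ‖ ^ 2

lemma fourier_fourierInv_schwartz {E : Type} [NormedAddCommGroup E] [InnerProductSpace ℝ E]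
    [MeasurableSpace E] [BorelSpace E] [FiniteDimensional ℝ E] (H : 𝓢(E, ℂ)) :
    𝓕 (𝓕⁻ (H : E → ℂ)) = H := by
  rw [← SchwartzMap.fourierInv_coe, ← SchwartzMap.fourier_coe, FourierTransform.fourier_fourierInv_eq]

lemma evolution_tensor {n m : ℕ} (h : m < n) (H₁ : 𝓢(ℝ, ℂ))
    (H₂ : 𝓢(EuclideanSpace ℝ (Fin (n - m - 1)), ℂ)) (H₃ : 𝓢(EuclideanSpace ℝ (Fin m), ℂ))
    (t : ℝ) (x : EuclideanSpace ℝ (Fin n)) :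
    evolution t (tensor h (𝓕⁻ (H₁ : ℝ → ℂ)) (𝓕⁻ (H₂ : _ → ℂ)) (𝓕⁻ (H₃ : _ → ℂ))) x =
      tensor h (phaseIntegral t H₁) (phaseIntegral t H₂) (phaseIntegral t H₃) x := by
  rw [evolution, fourier_tensor]
  simp only [fourier_fourierInv_schwartz]
  rw [tensor]
  simp only [phaseIntegral]
  rw [← integral_tensor h]
  refine integral_congr_ae (.of_forall fun ξ => ?_)
  simp only [tensor]
  rw [inner_eq_split h, norm_sq_eq_split h ξ, ← mul_assoc, ← mul_assoc]
  have : ∀ a b c a' b' c' : ℝ, e (a + b + c + t * (a' + b' + c')) =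
      e (a + t * a') * e (b + t * b') * e (c + t * c') := by
    intro a b c a' b' c'
    rw [← e_add, ← e_add]
    congr 1
    ring
  rw [this]
  ring

lemma integral_norm_sq_fourierInv {E : Type} [NormedAddCommGroup E] [InnerProductSpace ℝ E]
    [MeasurableSpace E] [BorelSpace E] [FiniteDimensional ℝ E] (H : 𝓢(E, ℂ)) :
    normSq (𝓕⁻ (H : E → ℂ)) = normSq (H : E → ℂ) := by
  rw [normSq, normSq, ← SchwartzMap.fourierInv_coe, ← SchwartzMap.integral_norm_sq_fourier,
    FourierTransform.fourier_fourierInv_eq]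

/-- Plancherel's theorem in each block. -/
lemma normL2_tensor {n m : ℕ} (h : m < n) (H₁ : 𝓢(ℝ, ℂ))
    (H₂ : 𝓢(EuclideanSpace ℝ (Fin (n - m - 1)), ℂ)) (H₃ : 𝓢(EuclideanSpace ℝ (Fin m), ℂ)) :
    normL2 (tensor h (𝓕⁻ (H₁ : ℝ → ℂ)) (𝓕⁻ (H₂ : _ → ℂ)) (𝓕⁻ (H₃ : _ → ℂ))) =
      √(normSq H₁) * √(normSq H₂) * √(normSq H₃) := by
  have key : normSq (tensor h (𝓕⁻ (H₁ : ℝ → ℂ)) (𝓕⁻ (H₂ : _ → ℂ)) (𝓕⁻ (H₃ : _ → ℂ))) =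
      normSq H₁ * normSq H₂ * normSq H₃ := by
    rw [← integral_norm_sq_fourierInv H₁, ← integral_norm_sq_fourierInv H₂,
      ← integral_norm_sq_fourierInv H₃]
    have := integral_tensor h (fun x => ((‖𝓕⁻ (H₁ : ℝ → ℂ) x‖ ^ 2 : ℝ) : ℂ))
      (fun x => ((‖𝓕⁻ (H₂ : _ → ℂ) x‖ ^ 2 : ℝ) : ℂ)) (fun x => ((‖𝓕⁻ (H₃ : _ → ℂ) x‖ ^ 2 : ℝ) : ℂ))
    simp only [tensor, integral_complex_ofReal, ← Complex.ofReal_mul] at this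
    have := Complex.ofReal_injective this
    rw [normSq, normSq, normSq, normSq, ← this]
    refine integral_congr_ae (.of_forall fun x => ?_)
    simp only [tensor, norm_mul]
    ring
  have hc : Continuous (tensor h (𝓕⁻ (H₁ : ℝ → ℂ)) (𝓕⁻ (H₂ : _ → ℂ)) (𝓕⁻ (H₃ : _ → ℂ))) := by
    rw [← SchwartzMap.fourierInv_coe, ← SchwartzMap.fourierInv_coe, ← SchwartzMap.fourierInv_coe]
    unfold tensor firstPart middlePart lastPart
    have h1 := (𝓕⁻ H₁).continuous
    have h2 := (𝓕⁻ H₂).continuous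
    have h3 := (𝓕⁻ H₃).continuous
    fun_prop
  have h₁ : 0 ≤ normSq H₁ := integral_nonneg fun _ => by positivity
  have h₂ : 0 ≤ normSq H₂ := integral_nonneg fun _ => by positivity
  rw [normL2, toReal_eLpNorm hc.aestronglyMeasurable,
    lpNorm_eq_integral_norm_rpow_toReal two_ne_zero ENNReal.ofNat_ne_top hc.aestronglyMeasurable]
  rw [← Real.sqrt_mul h₁, ← Real.sqrt_mul (mul_nonneg h₁ h₂), ← key, Real.sqrt_eq_rpow, normSq]
  norm_num

/-! ### Quantities of the same size -/

/-- `a` and `b` agree up to the factor `K`. -/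
def SameSize (K a b : ℝ) : Prop := K⁻¹ * b ≤ a ∧ a ≤ K * b

lemma SameSize.mul {K L a b a' b' : ℝ} (hK : 0 < K) (hL : 0 < L) (hb : 0 ≤ b) (hb' : 0 ≤ b')
    (h : SameSize K a b) (h' : SameSize L a' b') : SameSize (K * L) (a * a') (b * b') := by
  have ha : 0 ≤ a := le_trans (by positivity) h.1
  have ha' : 0 ≤ a' := le_trans (by positivity) h'.1
  constructor
  · calc (K * L)⁻¹ * (b * b') = (K⁻¹ * b) * (L⁻¹ * b') := by rw [mul_inv]; ring
      _ ≤ a * a' := mul_le_mul h.1 h'.1 (by positivity) ha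
  · calc a * a' ≤ (K * b) * (L * b') := mul_le_mul h.2 h'.2 ha' (by positivity)
      _ = _ := by ring

lemma SameSize.inv {K a b : ℝ} (hK : 0 < K) (hb : 0 < b) (h : SameSize K a b) :
    SameSize K a⁻¹ b⁻¹ := by
  have ha : 0 < a := lt_of_lt_of_le (by positivity) h.1
  constructor
  · rw [← mul_inv]
    exact inv_anti₀ ha h.2
  · have := inv_anti₀ (by positivity) h.1
    rwa [mul_inv, inv_inv] at this

lemma SameSize.sqrt {K a b : ℝ} (hK : 0 < K) (h : SameSize K a b) :
    SameSize (√K) (√a) (√b) := by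
  constructor
  · rw [← Real.sqrt_inv, ← Real.sqrt_mul (by positivity)]
    exact Real.sqrt_le_sqrt h.1
  · rw [← Real.sqrt_mul hK.le]
    exact Real.sqrt_le_sqrt h.2

lemma SameSize.div_sqrt {K L a b s u : ℝ} (hK : 0 < K) (hL : 0 < L) (hb : 0 ≤ b) (hu : 0 < u)
    (h : SameSize K a b) (h' : SameSize L s u) : SameSize (K * √L) (a / √s) (b / √u) := by
  rw [div_eq_mul_inv, div_eq_mul_inv]
  exact h.mul hK (by positivity) hb (by positivity)
    ((h'.sqrt hL).inv (by positivity) (by positivity))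

lemma SameSize.mono {K L a b : ℝ} (hK : 0 < K) (hKL : K ≤ L) (hb : 0 ≤ b) (h : SameSize K a b) :
    SameSize L a b :=
  ⟨(mul_le_mul_of_nonneg_right (inv_anti₀ hK hKL) hb).trans h.1,
    h.2.trans (mul_le_mul_of_nonneg_right hKL hb)⟩

lemma SameSize.trans {K L a b c : ℝ} (hK : 0 < K)
    (h : SameSize K a b) (h' : SameSize L b c) : SameSize (K * L) a c := by
  constructor
  · calc (K * L)⁻¹ * c = K⁻¹ * (L⁻¹ * c) := by rw [mul_inv]; ring
      _ ≤ K⁻¹ * b := mul_le_mul_of_nonneg_left h'.1 (by positivity)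
      _ ≤ a := h.1
  · calc a ≤ K * b := h.2
      _ ≤ K * (L * c) := mul_le_mul_of_nonneg_left h'.2 hK.le
      _ = _ := by ring

lemma sameSize_const_mul {k b : ℝ} (hk : 0 < k) (hb : 0 ≤ b) :
    SameSize (max k k⁻¹) (k * b) b := by
  constructor
  · refine mul_le_mul_of_nonneg_right ?_ hb
    calc (max k k⁻¹)⁻¹ ≤ (k⁻¹)⁻¹ := inv_anti₀ (by positivity) (le_max_right _ _)
      _ = k := inv_inv k
  · exact mul_le_mul_of_nonneg_right (le_max_left _ _) hb

lemma sameSize_of_between {k₁ k₂ a b : ℝ} (hk₁ : 0 < k₁) (hb : 0 ≤ b)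
    (h₁ : k₁ * b ≤ a) (h₂ : a ≤ k₂ * b) : SameSize (max k₂ k₁⁻¹) a b := by
  constructor
  · refine le_trans (mul_le_mul_of_nonneg_right ?_ hb) h₁
    calc (max k₂ k₁⁻¹)⁻¹ ≤ (k₁⁻¹)⁻¹ := inv_anti₀ (by positivity) (le_max_right _ _)
      _ = k₁ := inv_inv k₁
  · exact h₂.trans (mul_le_mul_of_nonneg_right (le_max_left _ _) hb)

/-! ### Integrals with a slowly varying phase -/

lemma half_le_re_e {θ : ℝ} (h : |θ| ≤ 1 / 6) : 1 / 2 ≤ (e θ).re := by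
  have h1 : e θ = Complex.exp ((2 * Real.pi * θ : ℝ) * Complex.I) := by
    rw [e]
    push_cast
    rfl
  rw [h1, Complex.exp_ofReal_mul_I_re, ← Real.cos_abs, ← Real.cos_pi_div_three]
  have hpi := Real.pi_pos
  rw [abs_mul, abs_of_pos (by positivity : (0 : ℝ) < 2 * Real.pi)]
  apply Real.cos_le_cos_of_nonneg_of_le_pi
  · positivity
  · linarith
  · nlinarith

/-- A nonnegative weight integrated against a phase of size at most `1 / 6` loses at most half of
its mass. -/
lemma half_integral_le_re {α : Type*} [MeasurableSpace α] {μ : Measure α} {ρ : α → ℝ} {θ : α → ℝ}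
    (hρ : ∀ x, 0 ≤ ρ x) (hi : Integrable ρ μ) (hθm : AEStronglyMeasurable θ μ)
    (hθ : ∀ x, ρ x ≠ 0 → |θ x| ≤ 1 / 6) :
    1 / 2 * ∫ x, ρ x ∂μ ≤ (∫ x, (ρ x : ℂ) * e (θ x) ∂μ).re := by
  have hint : Integrable (fun x => (ρ x : ℂ) * e (θ x)) μ := by
    refine hi.norm.mono' (hi.ofReal.aestronglyMeasurable.mul
      (continuous_e.comp_aestronglyMeasurable hθm)) (.of_forall fun x => ?_)
    simp [norm_e]
  have hre := integral_re hint
  simp only [RCLike.re_to_complex] at hre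
  rw [← hre, ← integral_const_mul]
  refine integral_mono (hi.const_mul _) hint.re fun x => ?_
  simp only [Complex.re_ofReal_mul]
  by_cases h0 : ρ x = 0
  · simp [h0]
  · nlinarith [half_le_re_e (hθ x h0), hρ x]

lemma norm_integral_phase_le {α : Type*} [MeasurableSpace α] {μ : Measure α} {ρ : α → ℝ}
    (θ : α → ℝ) (hρ : ∀ x, 0 ≤ ρ x) :
    ‖∫ x, (ρ x : ℂ) * e (θ x) ∂μ‖ ≤ ∫ x, ρ x ∂μ := by
  refine (norm_integral_le_integral_norm _).trans (le_of_eq ?_)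
  refine integral_congr_ae (.of_forall fun x => ?_)
  simp [norm_e, abs_of_nonneg (hρ x)]

/-! ### Bumps on the Fourier side -/

lemma schwartz_exists_ne_zero {E : Type} [NormedAddCommGroup E] [InnerProductSpace ℝ E]
    {Φ : 𝓢(E, ℂ)} (h : Φ ≠ 0) : ∃ ξ, Φ ξ ≠ 0 := by
  by_contra! h0
  exact h (SchwartzMap.ext h0)

section Bump

variable {E : Type} [NormedAddCommGroup E] [InnerProductSpace ℝ E]
  [MeasurableSpace E] [BorelSpace E] [FiniteDimensional ℝ E]

/-- A nonzero and nonnegative Schwartz function supported in the ball of radius `1 / 20` about the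
origin. -/
structure IsBump (Φ : 𝓢(E, ℂ)) : Prop where
  ne_zero : Φ ≠ 0
  eq_norm : ∀ ξ, Φ ξ = (‖Φ ξ‖ : ℂ)
  support : ∀ ξ, Φ ξ ≠ 0 → ‖ξ‖ ≤ 1 / 20

lemma IsFourierBump.isBump {φ : 𝓢(E, ℂ)} (h : IsFourierBump (1 / 20) φ) :
    IsBump (𝓕 φ : 𝓢(E, ℂ)) where
  ne_zero h0 := h.ne_zero <| by
    rw [← FourierTransform.fourierInv_fourier_eq (F := 𝓢(E, ℂ)) φ, h0]
    exact FourierTransform.fourierInv_zero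
  eq_norm ξ := by
    have h1 : (𝓕 φ : 𝓢(E, ℂ)) ξ = 𝓕 (φ : E → ℂ) ξ := rfl
    have h2 : 𝓕 (φ : E → ℂ) ξ = ((𝓕 (φ : E → ℂ) ξ).re : ℂ) :=
      Complex.ext rfl (by simpa using h.fourier_im_eq_zero ξ)
    rw [h1, h2, Complex.norm_real, Real.norm_of_nonneg (h.fourier_re_nonneg ξ)]
  support ξ h0 := by
    by_contra hlt
    exact h0 (h.fourier_support ξ (not_le.mp hlt))

/-- The integral of a bump. -/
noncomputable def mass (Φ : 𝓢(E, ℂ)) : ℝ := ∫ ξ, ‖Φ ξ‖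

lemma integrable_norm_sq (Φ : 𝓢(E, ℂ)) : Integrable fun ξ => ‖Φ ξ‖ ^ 2 := by
  have := (Φ.memLp 2 volume).integrable_norm_pow (two_ne_zero)
  simpa using this

lemma mass_pos {Φ : 𝓢(E, ℂ)} (h : Φ ≠ 0) : 0 < mass Φ := by
  obtain ⟨ξ, hξ⟩ := schwartz_exists_ne_zero h
  exact integral_pos_of_integrable_nonneg_nonzero (x := ξ) Φ.continuous.norm Φ.integrable.norm
    (fun _ => norm_nonneg _) (by simpa using hξ)

lemma normSq_pos {Φ : 𝓢(E, ℂ)} (h : Φ ≠ 0) : 0 < normSq (Φ : E → ℂ) := by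
  obtain ⟨ξ, hξ⟩ := schwartz_exists_ne_zero h
  exact integral_pos_of_integrable_nonneg_nonzero (x := ξ) (Φ.continuous.norm.pow 2)
    (integrable_norm_sq Φ) (fun _ => by positivity) (by simpa using hξ)

end Bump

/-! ### The first block -/

/-- The Fourier side of the first block, `ξ ↦ Φ ((ξ - R) / √R)`. -/
noncomputable def firstFourier (Φ : 𝓢(ℝ, ℂ)) {R : ℝ} (hR : 0 < R) : 𝓢(ℝ, ℂ) :=
  SchwartzMap.compCLMOfAntilipschitz (g := fun ξ : ℝ => (ξ - R) / √R) (K := (√R).toNNReal) ℂ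
    (by simp only [div_eq_mul_inv]; fun_prop)
    (AntilipschitzWith.of_le_mul_dist fun x y => by
      have hs : 0 < √R := Real.sqrt_pos.mpr hR
      rw [Real.coe_toNNReal _ hs.le, Real.dist_eq, Real.dist_eq, ← sub_div, abs_div,
        abs_of_pos hs, mul_div_cancel₀ _ hs.ne']
      simp) Φ

lemma firstFourier_apply (Φ : 𝓢(ℝ, ℂ)) {R : ℝ} (hR : 0 < R) (ξ : ℝ) :
    firstFourier Φ hR ξ = Φ ((ξ - R) / √R) := rfl

lemma integral_comp_sub_div {F : Type*} [NormedAddCommGroup F] [NormedSpace ℝ F] (f : ℝ → F)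
    (R : ℝ) {a : ℝ} (ha : 0 < a) : ∫ ξ, f ((ξ - R) / a) = a • ∫ η, f η := by
  rw [integral_sub_right_eq_self (fun ξ => f (ξ / a)) R, Measure.integral_comp_div, abs_of_pos ha]

lemma normSq_firstFourier (Φ : 𝓢(ℝ, ℂ)) {R : ℝ} (hR : 0 < R) :
    normSq (firstFourier Φ hR : ℝ → ℂ) = √R * normSq (Φ : ℝ → ℂ) := by
  simp only [normSq, firstFourier_apply]
  rw [integral_comp_sub_div (fun η => ‖Φ η‖ ^ 2) R (Real.sqrt_pos.mpr hR), smul_eq_mul]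

/-- In the frequency variable `η = (ξ - R) / √R` the phase is linear with slope `√R (x + 2 R t)`,
apart from a small quadratic term. -/
lemma phaseIntegral_firstFourier (Φ : 𝓢(ℝ, ℂ)) {R : ℝ} (hR : 0 < R) (t x : ℝ) :
    phaseIntegral t (firstFourier Φ hR) x =
      √R * e (x * R + t * R ^ 2) *
        ∫ η, Φ η * e (√R * (x + 2 * R * t) * η + t * R * η ^ 2) := by
  have hs : 0 < √R := Real.sqrt_pos.mpr hR
  have hsq : √R ^ 2 = R := Real.sq_sqrt hR.le
  have h1 : phaseIntegral t (firstFourier Φ hR) x =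
      ∫ ξ, (fun η => Φ η * e (x * (R + √R * η) + t * (R + √R * η) ^ 2)) ((ξ - R) / √R) := by
    refine integral_congr_ae (.of_forall fun ξ => ?_)
    simp only [firstFourier_apply]
    rw [mul_div_cancel₀ _ hs.ne', add_sub_cancel]
    congr 2
    simp [mul_comm]
  rw [h1, integral_comp_sub_div
    (fun η => Φ η * e (x * (R + √R * η) + t * (R + √R * η) ^ 2)) R hs, Complex.real_smul, mul_assoc,
    ← integral_const_mul (e (x * R + t * R ^ 2))]
  refine congrArg ((√R : ℂ) * ·) (integral_congr_ae (.of_forall fun η => ?_))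
  simp only
  rw [mul_left_comm, ← e_add]
  congr 2
  linear_combination (t * η ^ 2) * hsq

/-- The first block is focused where `|x₁ + 2 R t| ≤ R^{-1/2}`. -/
lemma sameSize_first {Φ : 𝓢(ℝ, ℂ)} (hΦ : IsBump Φ) :
    ∃ K : ℝ, 0 < K ∧ ∀ {R : ℝ} (hR : 1 ≤ R) {t x : ℝ}, |t| ≤ 1 / R → |x + 2 * R * t| ≤ 1 / √R →
      SameSize K (‖phaseIntegral t (firstFourier Φ (one_pos.trans_le hR)) x‖ /
        √(normSq (firstFourier Φ (one_pos.trans_le hR) : ℝ → ℂ))) (R ^ (1 / 4 : ℝ)) := by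
  have hI := mass_pos hΦ.ne_zero
  have hN := normSq_pos hΦ.ne_zero
  refine ⟨max (mass Φ) (1 / 2 * mass Φ)⁻¹ * √(max (normSq Φ) (normSq Φ)⁻¹), by positivity, ?_⟩
  intro R hR t x ht hx
  have hR0 : 0 < R := by linarith
  have hs : 0 < √R := Real.sqrt_pos.mpr hR0
  have hquarter : R ^ (1 / 4 : ℝ) = √R / √(√R) := by
    rw [Real.div_sqrt, Real.sqrt_eq_rpow, Real.sqrt_eq_rpow, ← Real.rpow_mul hR0.le]
    norm_num
  rw [hquarter]
  refine SameSize.div_sqrt (by positivity) (by positivity) hs.le hs ?_ ?_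
  · rw [phaseIntegral_firstFourier, norm_mul, norm_mul, norm_e, mul_one, Complex.norm_real,
      Real.norm_of_nonneg hs.le]
    have hcongr : ∫ η, Φ η * e (√R * (x + 2 * R * t) * η + t * R * η ^ 2) =
        ∫ η, (‖Φ η‖ : ℂ) * e (√R * (x + 2 * R * t) * η + t * R * η ^ 2) := by
      refine integral_congr_ae (.of_forall fun η => ?_)
      simp only
      rw [← hΦ.eq_norm]
    rw [hcongr]
    refine sameSize_of_between (by positivity) hs.le ?_ ?_
    · rw [mul_comm]
      refine mul_le_mul_of_nonneg_left ?_ hs.le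
      refine (half_integral_le_re (ρ := fun η => ‖Φ η‖) (fun _ => norm_nonneg _) Φ.integrable.norm
        (by fun_prop) fun η hη => ?_).trans (Complex.re_le_norm _)
      have hη' := hΦ.support η (by simpa using hη)
      rw [Real.norm_eq_abs] at hη'
      have h1 : |√R * (x + 2 * R * t)| ≤ 1 := by
        rw [abs_mul, abs_of_pos hs]
        calc √R * |x + 2 * R * t| ≤ √R * (1 / √R) := by gcongr
          _ = 1 := by field_simp
      have h2 : |t * R| ≤ 1 := by
        rw [abs_mul, abs_of_pos hR0]
        calc |t| * R ≤ 1 / R * R := by gcongr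
          _ = 1 := by field_simp
      calc _ ≤ |√R * (x + 2 * R * t) * η| + |t * R * η ^ 2| := abs_add_le _ _
        _ ≤ 1 * (1 / 20) + 1 * (1 / 20) ^ 2 := by
          rw [abs_mul, abs_mul (t * R), abs_pow]
          gcongr
        _ ≤ 1 / 6 := by norm_num
    · rw [mul_comm]
      exact mul_le_mul_of_nonneg_right (norm_integral_phase_le _ fun _ => norm_nonneg _) hs.le
  · rw [normSq_firstFourier, mul_comm]
    exact sameSize_const_mul hN hs.le

/-! ### Sums of separated bumps -/

section Lattice

variable {d : ℕ}

/-- The Fourier side of a lattice block: the bump `Φ` repeated along the points `D l`, `l ∈ A`,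
with weights `α l`. -/
noncomputable def latticeFourier (A : Finset (Fin d → ℤ)) (α : (Fin d → ℤ) → ℝ) (D : ℝ)
    (Φ : 𝓢(EuclideanSpace ℝ (Fin d), ℂ)) : 𝓢(EuclideanSpace ℝ (Fin d), ℂ) :=
  ∑ l ∈ A, (α l : ℂ) • SchwartzMap.compSubConstCLM ℂ (D • latticePoint l) Φ

lemma latticeFourier_apply (A : Finset (Fin d → ℤ)) (α : (Fin d → ℤ) → ℝ) (D : ℝ)
    (Φ : 𝓢(EuclideanSpace ℝ (Fin d), ℂ)) (ξ : EuclideanSpace ℝ (Fin d)) :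
    latticeFourier A α D Φ ξ = ∑ l ∈ A, (α l : ℂ) * Φ (ξ - D • latticePoint l) := by
  simp [latticeFourier]

lemma one_le_norm_latticePoint_sub {l l' : Fin d → ℤ} (h : l ≠ l') :
    1 ≤ ‖latticePoint l - latticePoint l'‖ := by
  obtain ⟨i, hi⟩ := Function.ne_iff.mp h
  have h1 : (1 : ℝ) ≤ |((l i - l' i : ℤ) : ℝ)| := by
    rw [← Int.cast_abs]
    exact_mod_cast Int.one_le_abs (sub_ne_zero.mpr hi)
  refine h1.trans ?_
  have := PiLp.norm_apply_le (latticePoint l - latticePoint l') i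
  simpa [latticePoint] using this

/-- Distinct translates have disjoint supports. -/
lemma IsBump.translate_mul_translate {Φ : 𝓢(EuclideanSpace ℝ (Fin d), ℂ)} (hΦ : IsBump Φ) {D : ℝ}
    (hD : 1 ≤ D) {l l' : Fin d → ℤ} (h : l ≠ l') (ξ : EuclideanSpace ℝ (Fin d)) :
    ‖Φ (ξ - D • latticePoint l)‖ * ‖Φ (ξ - D • latticePoint l')‖ = 0 := by
  by_contra h0
  obtain ⟨h1, h2⟩ := mul_ne_zero_iff.mp h0
  have h1 := hΦ.support _ (norm_ne_zero_iff.mp h1)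
  have h2 := hΦ.support _ (norm_ne_zero_iff.mp h2)
  have h3 : ‖D • (latticePoint l - latticePoint l')‖ ≤ 1 / 20 + 1 / 20 := by
    have : D • (latticePoint l - latticePoint l') =
        (ξ - D • latticePoint l') - (ξ - D • latticePoint l) := by
      rw [smul_sub]
      abel
    rw [this]
    exact (norm_sub_le _ _).trans (add_le_add h2 h1)
  rw [norm_smul, Real.norm_of_nonneg (by linarith)] at h3
  nlinarith [one_le_norm_latticePoint_sub h]

/-- Separated bumps are orthogonal. -/
lemma normSq_latticeFourier (A : Finset (Fin d → ℤ)) {α : (Fin d → ℤ) → ℝ} (hα : ∀ l, 0 ≤ α l)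
    {D : ℝ} (hD : 1 ≤ D) {Φ : 𝓢(EuclideanSpace ℝ (Fin d), ℂ)} (hΦ : IsBump Φ) :
    normSq (latticeFourier A α D Φ : _ → ℂ) = (∑ l ∈ A, α l ^ 2) * normSq (Φ : _ → ℂ) := by
  have hpt (ξ : EuclideanSpace ℝ (Fin d)) : ‖latticeFourier A α D Φ ξ‖ ^ 2 =
      ∑ l ∈ A, α l ^ 2 * ‖Φ (ξ - D • latticePoint l)‖ ^ 2 := by
    have h1 : latticeFourier A α D Φ ξ =
        ((∑ l ∈ A, α l * ‖Φ (ξ - D • latticePoint l)‖ : ℝ) : ℂ) := by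
      rw [latticeFourier_apply]
      push_cast
      exact Finset.sum_congr rfl fun l _ => by rw [← hΦ.eq_norm]
    rw [h1, Complex.norm_real, Real.norm_of_nonneg
      (Finset.sum_nonneg fun l _ => mul_nonneg (hα l) (norm_nonneg _)), sq, Finset.sum_mul_sum]
    refine Finset.sum_congr rfl fun l hl => ?_
    rw [Finset.sum_eq_single_of_mem l hl]
    · ring
    · intro l' _ hne
      have := hΦ.translate_mul_translate hD hne.symm ξ
      linear_combination α l * α l' * this
  simp only [normSq, hpt]
  rw [integral_finsetSum, Finset.sum_mul]
  · refine Finset.sum_congr rfl fun l _ => ?_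
    rw [integral_const_mul, integral_sub_right_eq_self (fun ξ => ‖Φ ξ‖ ^ 2)]
  · intro l _
    exact ((integrable_norm_sq Φ).comp_sub_right _).const_mul _

lemma integrable_mul_phase {Φ : 𝓢(EuclideanSpace ℝ (Fin d), ℂ)}
    {θ : EuclideanSpace ℝ (Fin d) → ℝ} (hθ : Continuous θ) : Integrable fun ξ => Φ ξ * e (θ ξ) := by
  refine Φ.integrable.norm.mono' (Φ.continuous.mul (continuous_e.comp hθ)).aestronglyMeasurable
    (.of_forall fun ξ => ?_)
  simp [norm_e]

lemma phaseIntegral_latticeFourier (A : Finset (Fin d → ℤ)) (α : (Fin d → ℤ) → ℝ) (D : ℝ)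
    (Φ : 𝓢(EuclideanSpace ℝ (Fin d), ℂ)) (t : ℝ) (x : EuclideanSpace ℝ (Fin d)) :
    phaseIntegral t (latticeFourier A α D Φ) x = ∑ l ∈ A, (α l : ℂ) *
      ∫ η, Φ η * e (inner ℝ x (η + D • latticePoint l) + t * ‖η + D • latticePoint l‖ ^ 2) := by
  obtain ⟨G, hG⟩ : ∃ G : (Fin d → ℤ) → EuclideanSpace ℝ (Fin d) → ℂ, ∀ l, G l = fun η =>
      Φ η * e (inner ℝ x (η + D • latticePoint l) + t * ‖η + D • latticePoint l‖ ^ 2) :=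
    ⟨_, fun _ => rfl⟩
  have hint (l : Fin d → ℤ) : Integrable (G l) := by
    rw [hG]
    exact integrable_mul_phase (by fun_prop)
  have hshift (l : Fin d → ℤ) : ∀ ξ, Φ (ξ - D • latticePoint l) * e (inner ℝ x ξ + t * ‖ξ‖ ^ 2) =
      G l (ξ - D • latticePoint l) := fun ξ => by
    simp only [hG, sub_add_cancel]
  simp only [phaseIntegral, latticeFourier_apply, Finset.sum_mul, mul_assoc, hshift, ← hG]
  rw [integral_finsetSum]
  · refine Finset.sum_congr rfl fun l _ => ?_
    rw [integral_const_mul, integral_sub_right_eq_self (G l)]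
  · intro l _
    exact ((hint l).comp_sub_right _).const_mul _

end Lattice

/-! ### Counting lattice points -/

section Count

variable {d : ℕ}

lemma norm_le_of_coord_le {v : EuclideanSpace ℝ (Fin d)} {s : ℝ} (hs : 0 ≤ s)
    (h : ∀ i, |v i| ≤ s) : ‖v‖ ≤ d * s := by
  refine abs_le_of_sq_le_sq' ?_ (by positivity) |>.2
  rw [EuclideanSpace.norm_sq_eq]
  calc ∑ i, ‖v i‖ ^ 2 ≤ ∑ _i : Fin d, s ^ 2 := by
        refine Finset.sum_le_sum fun i _ => ?_
        rw [Real.norm_eq_abs]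
        gcongr
        exact h i
    _ = d * s ^ 2 := by simp
    _ ≤ (d : ℝ) ^ 2 * s ^ 2 := by
        gcongr
        exact_mod_cast Nat.le_self_pow two_ne_zero d
    _ = (d * s) ^ 2 := by ring

lemma abs_coord_le_norm_latticePoint (l : Fin d → ℤ) (i : Fin d) :
    |(l i : ℝ)| ≤ ‖latticePoint l‖ := by
  simpa [latticePoint] using PiLp.norm_apply_le (latticePoint l) i

lemma inner_latticePoint (p l : Fin d → ℤ) :
    inner ℝ (latticePoint p) (latticePoint l) = ((∑ i, p i * l i : ℤ) : ℝ) := by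
  simp [latticePoint, PiLp.inner_apply, mul_comm]

/-- The integer points of the cube `[-s, s]^d`. -/
noncomputable def latticeCube (d : ℕ) (s : ℝ) : Finset (Fin d → ℤ) :=
  Fintype.piFinset fun _ => Finset.Icc (-⌊s⌋) ⌊s⌋

lemma mem_latticeCube {s : ℝ} {l : Fin d → ℤ} : l ∈ latticeCube d s ↔ ∀ i, |(l i : ℝ)| ≤ s := by
  simp only [latticeCube, Fintype.mem_piFinset, Finset.mem_Icc]
  refine forall_congr' fun i => ?_
  rw [← abs_le, Int.le_floor, Int.cast_abs]

lemma card_latticeCube {s : ℝ} (hs : 0 ≤ s) :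
    ((latticeCube d s).card : ℝ) = (2 * ⌊s⌋ + 1) ^ d := by
  have hf : (0 : ℤ) ≤ ⌊s⌋ := Int.floor_nonneg.mpr hs
  have h : (((⌊s⌋ + 1 - -⌊s⌋).toNat : ℤ) : ℝ) = 2 * ⌊s⌋ + 1 := by
    rw [Int.toNat_of_nonneg (by omega)]
    push_cast
    ring
  rw [Int.cast_natCast] at h
  rw [latticeCube, Fintype.card_piFinset_const, Int.card_Icc, Nat.cast_pow, h]

lemma card_latticeCube_le {s : ℝ} (hs : 0 ≤ s) :
    ((latticeCube d s).card : ℝ) ≤ (2 * s + 1) ^ d := by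
  have hf : (0 : ℝ) ≤ ⌊s⌋ := by exact_mod_cast Int.floor_nonneg.mpr hs
  rw [card_latticeCube hs]
  have := Int.floor_le s
  gcongr

lemma pow_le_card_latticeCube {s : ℝ} (hs : 0 ≤ s) :
    s ^ d ≤ ((latticeCube d s).card : ℝ) := by
  have hf : (0 : ℝ) ≤ ⌊s⌋ := by exact_mod_cast Int.floor_nonneg.mpr hs
  rw [card_latticeCube hs]
  have := (Int.lt_floor_add_one s).le
  gcongr
  linarith

open Classical in
/-- The integer points of the ball of radius `r` about the origin. -/
noncomputable def latticeBall (d : ℕ) (r : ℝ) : Finset (Fin d → ℤ) :=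
  (latticeCube d r).filter fun l => ‖latticePoint l‖ ≤ r

lemma mem_latticeBall {r : ℝ} {l : Fin d → ℤ} : l ∈ latticeBall d r ↔ ‖latticePoint l‖ ≤ r := by
  classical
  rw [latticeBall, Finset.mem_filter, and_iff_right_iff_imp, mem_latticeCube]
  exact fun h i => (abs_coord_le_norm_latticePoint l i).trans h

lemma card_latticeBall_le {r : ℝ} (hr : 0 ≤ r) :
    ((latticeBall d r).card : ℝ) ≤ (2 * r + 1) ^ d := by
  classical
  refine le_trans ?_ (card_latticeCube_le hr)
  exact_mod_cast Finset.card_filter_le _ _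

lemma pow_le_card_latticeBall {r : ℝ} (hr : 0 ≤ r) :
    (r / (d + 1)) ^ d ≤ ((latticeBall d r).card : ℝ) := by
  refine (pow_le_card_latticeCube (by positivity)).trans ?_
  have : latticeCube d (r / (d + 1)) ⊆ latticeBall d r := by
    intro l hl
    rw [mem_latticeCube] at hl
    rw [mem_latticeBall]
    refine (norm_le_of_coord_le (v := latticePoint l) (by positivity) hl).trans ?_
    rw [mul_div_assoc', div_le_iff₀ (by positivity)]
    nlinarith
  exact_mod_cast Finset.card_le_card this

end Count

/-! ### The last block -/

lemma rpow_half_natCast {a : ℝ} (ha : 0 < a) (m : ℕ) :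
    a ^ ((m : ℝ) / 2) = a ^ m / √(a ^ m) := by
  rw [Real.div_sqrt, Real.sqrt_eq_rpow, ← Real.rpow_natCast, ← Real.rpow_mul ha.le]
  congr 1
  ring

section Last

variable {m : ℕ}

/-- The Fourier side of the last block. -/
noncomputable def lastFourier (Φ : 𝓢(EuclideanSpace ℝ (Fin m), ℂ)) (c R D : ℝ) :
    𝓢(EuclideanSpace ℝ (Fin m), ℂ) :=
  latticeFourier (latticeBall m (c * √R / D)) 1 D Φ

lemma datumLast_eq (φ : 𝓢(EuclideanSpace ℝ (Fin m), ℂ)) (c R D : ℝ) :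
    datumLast φ c R D = 𝓕⁻ (lastFourier (𝓕 φ) c R D : EuclideanSpace ℝ (Fin m) → ℂ) := by
  rw [datumLast]
  congr 1
  ext ξ
  rw [lastFourier, latticeFourier_apply]
  refine (tsum_subtype {l : Fin m → ℤ | ‖latticePoint l‖ ≤ c * √R / D}
    fun l => 𝓕 (φ : EuclideanSpace ℝ (Fin m) → ℂ) (ξ - D • latticePoint l)).trans ?_
  rw [tsum_eq_sum (s := latticeBall m (c * √R / D))]
  · refine Finset.sum_congr rfl fun l hl => ?_
    have hl' : l ∈ {l : Fin m → ℤ | ‖latticePoint l‖ ≤ c * √R / D} := mem_latticeBall.mp hl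
    rw [Set.indicator_of_mem hl']
    simp [SchwartzMap.fourier_coe]
  · intro l hl
    have hl' : l ∉ {l : Fin m → ℤ | ‖latticePoint l‖ ≤ c * √R / D} :=
      fun h => hl (mem_latticeBall.mpr h)
    exact Set.indicator_of_notMem hl' _

/-- Near a point of `D⁻¹ ℤ^m` all the wave packets of the last block are in phase. -/
lemma sameSize_last {Φ : 𝓢(EuclideanSpace ℝ (Fin m), ℂ)} (hΦ : IsBump Φ) {c : ℝ} (hc : 0 < c)
    (hc' : c ≤ 1 / 20) :
    ∃ K : ℝ, 0 < K ∧ ∀ {R D t : ℝ} {p : Fin m → ℤ} {x : EuclideanSpace ℝ (Fin m)}, 1 ≤ R → 1 ≤ D →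
      D ≤ √R → |t| ≤ 1 / R → ‖x - D⁻¹ • latticePoint p‖ ≤ 1 / √R → ‖x‖ ≤ 1 →
      SameSize K (‖phaseIntegral t (lastFourier Φ c R D) x‖ /
        √(normSq (lastFourier Φ c R D : _ → ℂ))) ((√R / D) ^ ((m : ℝ) / 2)) := by
  have hI := mass_pos hΦ.ne_zero
  have hN := normSq_pos hΦ.ne_zero
  refine ⟨max (mass Φ) (1 / 2 * mass Φ)⁻¹ * max ((2 * c + 1) ^ m) ((c / (m + 1)) ^ m)⁻¹ *
    √(max (normSq Φ) (normSq Φ)⁻¹ * max ((2 * c + 1) ^ m) ((c / (m + 1)) ^ m)⁻¹), by positivity, ?_⟩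
  intro R D t p x hR hD hDR ht hx hx1
  have hR0 : 0 < R := by linarith
  have hD0 : 0 < D := by linarith
  have hs : 1 ≤ √R := Real.one_le_sqrt.mpr hR
  have hs0 : 0 < √R := by linarith
  have ha1 : 1 ≤ √R / D := (one_le_div hD0).mpr hDR
  have ha : 0 < √R / D := by positivity
  set A := latticeBall m (c * √R / D) with hA
  have hcard : SameSize (max ((2 * c + 1) ^ m) ((c / (m + 1)) ^ m)⁻¹) (A.card : ℝ)
      ((√R / D) ^ m) := by
    refine sameSize_of_between (by positivity) (by positivity) ?_ ?_
    · refine le_trans (le_of_eq ?_) (pow_le_card_latticeBall (d := m) (by positivity))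
      rw [← mul_pow]
      congr 1
      field_simp
    · refine (card_latticeBall_le (d := m) (by positivity)).trans ?_
      rw [← mul_pow]
      gcongr
      rw [mul_div_assoc]
      nlinarith
  rw [rpow_half_natCast ha]
  refine SameSize.div_sqrt (by positivity) (by positivity) (by positivity) (by positivity) ?_ ?_
  · refine SameSize.trans (by positivity) ?_ hcard
    -- the phases, after removing the integers `p ⬝ l`
    let θ (l : Fin m → ℤ) (η : EuclideanSpace ℝ (Fin m)) : ℝ := inner ℝ x η +
      inner ℝ (x - D⁻¹ • latticePoint p) (D • latticePoint l) + t * ‖η + D • latticePoint l‖ ^ 2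
    have hE : phaseIntegral t (lastFourier Φ c R D) x =
        ∑ l ∈ A, ∫ η, (‖Φ η‖ : ℂ) * e (θ l η) := by
      rw [lastFourier, phaseIntegral_latticeFourier]
      refine Finset.sum_congr rfl fun l _ => ?_
      simp only [Pi.one_apply, Complex.ofReal_one, one_mul]
      refine integral_congr_ae (.of_forall fun η => ?_)
      simp only
      rw [← hΦ.eq_norm]
      have h1 : inner ℝ x (η + D • latticePoint l) + t * ‖η + D • latticePoint l‖ ^ 2 =
          θ l η + ((∑ i, p i * l i : ℤ) : ℝ) := by
        simp only [θ]
        rw [← inner_latticePoint, inner_add_right, inner_sub_left, inner_smul_right,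
          inner_smul_right, real_inner_smul_left]
        field_simp
        ring
      rw [h1, e_add, e_intCast, mul_one]
    rw [hE]
    refine sameSize_of_between (by positivity) (by positivity) ?_ ?_
    · refine le_trans ?_ (Complex.re_le_norm _)
      rw [Complex.re_sum, mul_comm, ← nsmul_eq_mul]
      refine Finset.card_nsmul_le_sum _ _ _ fun l hl => ?_
      refine half_integral_le_re (ρ := fun η => ‖Φ η‖) (fun _ => norm_nonneg _)
        Φ.integrable.norm (Continuous.aestronglyMeasurable (by fun_prop)) fun η hη => ?_
      have hη' := hΦ.support η (by simpa using hη)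
      have hl' : ‖D • latticePoint l‖ ≤ 1 / 20 * √R := by
        rw [norm_smul, Real.norm_of_nonneg hD0.le]
        calc D * ‖latticePoint l‖ ≤ D * (c * √R / D) := by
              gcongr
              exact mem_latticeBall.mp hl
          _ = c * √R := by field_simp
          _ ≤ _ := by gcongr
      have h1 : |inner ℝ x η| ≤ 1 * (1 / 20) :=
        (abs_real_inner_le_norm _ _).trans (by gcongr)
      have h2 : |inner ℝ (x - D⁻¹ • latticePoint p) (D • latticePoint l)| ≤ 1 / 20 := by
        refine (abs_real_inner_le_norm _ _).trans ?_
        calc _ ≤ 1 / √R * (1 / 20 * √R) := by gcongr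
          _ = 1 / 20 := by field_simp
      have h3 : |t * ‖η + D • latticePoint l‖ ^ 2| ≤ 1 / 100 := by
        rw [abs_mul, abs_of_nonneg (by positivity : 0 ≤ ‖η + D • latticePoint l‖ ^ 2)]
        calc _ ≤ 1 / R * (1 / 20 * √R + 1 / 20 * √R) ^ 2 := by
              gcongr
              refine (norm_add_le _ _).trans (add_le_add (hη'.trans ?_) hl')
              linarith
          _ = (√R ^ 2 / R) * (1 / 100) := by ring
          _ = 1 / 100 := by rw [Real.sq_sqrt hR0.le, div_self hR0.ne', one_mul]
      refine (abs_add_three _ _ _).trans ?_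
      linarith
    · refine (norm_sum_le _ _).trans ?_
      rw [mul_comm, ← nsmul_eq_mul]
      exact Finset.sum_le_card_nsmul _ _ _ fun l _ =>
        norm_integral_phase_le _ fun _ => norm_nonneg _
  · rw [lastFourier, normSq_latticeFourier _ (α := 1) (fun _ => zero_le_one) hD hΦ,
      mul_comm _ (normSq (Φ : _ → ℂ))]
    refine SameSize.trans (by positivity) (sameSize_const_mul hN ?_) ?_
    · exact Finset.sum_nonneg fun _ _ => by positivity
    · simpa using hcard

end Last

/-! ### Quadratic Gauss sums -/

section Gauss

variable {q : ℕ} [NeZero q]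

/-- The quadratic Gauss sum `∑ e ((b r² + k r) / q)` over the residues `r` modulo `q`. -/
noncomputable def quadGauss (b k : ZMod q) : ℂ := ∑ r : ZMod q, ZMod.stdAddChar (b * r ^ 2 + k * r)

lemma norm_stdAddChar (x : ZMod q) : ‖(ZMod.stdAddChar x : ℂ)‖ = 1 := by
  rw [ZMod.stdAddChar_apply]
  exact Circle.norm_coe _

/-- The modulus of a Gauss sum to an odd modulus, by squaring: for `r = s + h` the phase difference
`b (r² - s²) + k (r - s)` is linear in `s` with slope `2 b h`, so only `h = 0` survives. -/
lemma norm_quadGauss (hq : Odd q) {b : ZMod q} (hb : IsUnit b) (k : ZMod q) :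
    ‖quadGauss b k‖ = √q := by
  have h2 : IsUnit (2 : ZMod q) := by
    have := (ZMod.isUnit_iff_coprime 2 q).mpr hq.coprime_two_left
    exact_mod_cast this
  have key : quadGauss b k * (starRingEnd ℂ) (quadGauss b k) = q := by
    have h1 : quadGauss b k * (starRingEnd ℂ) (quadGauss b k) =
        ∑ h : ZMod q, ZMod.stdAddChar (b * h ^ 2 + k * h) *
          ∑ s : ZMod q, (ZMod.stdAddChar (s * (2 * b * h)) : ℂ) := by
      simp only [quadGauss, map_sum, ← AddChar.map_neg_eq_conj, Finset.mul_sum, Finset.sum_mul,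
        ← AddChar.map_add_eq_mul]
      refine Eq.trans ?_ Finset.sum_comm
      refine Finset.sum_congr rfl fun s _ => ?_
      rw [← Equiv.sum_comp (Equiv.addRight s)]
      refine Finset.sum_congr rfl fun h _ => ?_
      congr 1
      simp only [Equiv.coe_addRight]
      ring
    rw [h1, Finset.sum_eq_single 0]
    · rw [AddChar.sum_mulShift _ (ZMod.isPrimitive_stdAddChar q)]
      simp [ZMod.card]
    · intro h _ hne
      rw [AddChar.sum_mulShift _ (ZMod.isPrimitive_stdAddChar q), if_neg, Nat.cast_zero, mul_zero]
      rwa [(h2.mul hb).mul_right_eq_zero]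
    · simp
  rw [Complex.mul_conj, Complex.normSq_eq_norm_sq] at key
  have key : ‖quadGauss b k‖ ^ 2 = (q : ℝ) := by exact_mod_cast key
  rw [← key, Real.sqrt_sq (norm_nonneg _)]

lemma norm_inv_mul_quadGauss (hq : Odd q) {b : ZMod q} (hb : IsUnit b) (k : ZMod q) :
    ‖(q : ℂ)⁻¹ * quadGauss b k‖ = (√q)⁻¹ := by
  have hq0 : (0 : ℝ) < q := by exact_mod_cast NeZero.pos q
  have : 0 < √(q : ℝ) := Real.sqrt_pos.mpr hq0
  rw [norm_mul, norm_quadGauss hq hb, norm_inv, Complex.norm_natCast]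
  nth_rewrite 1 [← Real.sq_sqrt hq0.le]
  field_simp

/-- The discrete Fourier transform of a quadratic phase has constant modulus. -/
lemma norm_dft_quadratic (hq : Odd q) {b : ZMod q} (hb : IsUnit b) (k v : ZMod q) :
    ‖ZMod.dft (fun r : ZMod q => (ZMod.stdAddChar (b * r ^ 2 + k * r) : ℂ)) v‖ = √q := by
  rw [← norm_quadGauss hq hb (k - v), ZMod.dft_apply, quadGauss]
  congr 1
  refine Finset.sum_congr rfl fun r _ => ?_
  rw [smul_eq_mul, ← AddChar.map_add_eq_mul]
  congr 1
  ring

/-! ### Exponential sums with smooth weights -/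

/-- Two summations by parts against the character `l ↦ e(v l / q)`. -/
lemma norm_sq_mul_norm_tsum_le {F : ℤ → ℂ} (hF : Summable F) (v : ZMod q) :
    ‖(ZMod.stdAddChar v : ℂ) - 1‖ ^ 2 * ‖∑' l : ℤ, ZMod.stdAddChar (v * (l : ZMod q)) * F l‖ ≤
      ∑' l : ℤ, ‖F (l + 2) - 2 * F (l + 1) + F l‖ := by
  set z : ℂ := ZMod.stdAddChar v with hz
  have hz1 : ‖z‖ = 1 := norm_stdAddChar v
  have hz0 : z ≠ 0 := norm_ne_zero_iff.mp (by rw [hz1]; exact one_ne_zero)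
  set u : ℤ → ℂ := fun l => ZMod.stdAddChar (v * (l : ZMod q)) with hu
  have hu1 (l : ℤ) : ‖u l‖ = 1 := norm_stdAddChar _
  have hstep (l : ℤ) : u (l + 1) = z * u l := by
    simp only [hu, hz]
    rw [← AddChar.map_add_eq_mul]
    congr 1
    push_cast
    ring
  have hs (G : ℤ → ℂ) (hG : Summable G) : Summable fun l => u l * G l := by
    refine Summable.of_norm_bounded hG.norm fun l => ?_
    rw [norm_mul, hu1, one_mul]
  have hshift (G : ℤ → ℂ) (hG : Summable G) : Summable fun l => G (l + 1) :=
    (Equiv.addRight (1 : ℤ)).summable_iff.mpr hG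
  have hT (G : ℤ → ℂ) : ∑' l, u l * G (l + 1) = z⁻¹ * ∑' l, u l * G l := by
    rw [← (Equiv.addRight (1 : ℤ)).tsum_eq fun l => u l * G l, ← tsum_mul_left]
    refine tsum_congr fun l => ?_
    simp only [Equiv.coe_addRight]
    rw [hstep]
    field_simp
  have hF1 := hshift F hF
  have hF2 : Summable fun l => F (l + 2) := by
    simpa only [add_assoc, one_add_one_eq_two] using hshift _ hF1
  have hT2 : ∑' l, u l * F (l + 2) = z⁻¹ ^ 2 * ∑' l, u l * F l := by
    have := hT fun l => F (l + 1)
    simp only [add_assoc, one_add_one_eq_two] at this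
    rw [this, hT]
    ring
  have hD : Summable fun l => F (l + 2) - 2 * F (l + 1) + F l :=
    (hF2.sub (hF1.mul_left 2)).add hF
  have hid : (z⁻¹ - 1) ^ 2 * ∑' l, u l * F l =
      ∑' l, u l * (F (l + 2) - 2 * F (l + 1) + F l) := by
    have h1 (l : ℤ) : u l * (F (l + 2) - 2 * F (l + 1) + F l) =
        u l * F (l + 2) - 2 * (u l * F (l + 1)) + u l * F l := by ring
    simp only [h1]
    rw [Summable.tsum_add ((hs _ hF2).sub ((hs _ hF1).mul_left 2)) (hs _ hF),
      Summable.tsum_sub (hs _ hF2) ((hs _ hF1).mul_left 2), tsum_mul_left, hT2, hT]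
    ring
  have hzz : ‖z - 1‖ = ‖z⁻¹ - 1‖ := by
    have : z - 1 = -(z * (z⁻¹ - 1)) := by field_simp; ring
    rw [this, norm_neg, norm_mul, hz1, one_mul]
  rw [hzz, ← norm_pow, ← norm_mul, hid]
  refine (norm_tsum_le_tsum_norm ?_).trans (le_of_eq ?_)
  · exact (hs _ hD).norm
  · exact tsum_congr fun l => by rw [norm_mul, hu1, one_mul]

/-- `|e(v / q) - 1|` is at least `4 / q` times the distance from `v` to the multiples of `q`. -/
lemma le_norm_stdAddChar_sub_one {v : ZMod q} (hv : v ≠ 0) :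
    4 * min (v.val : ℝ) ((-v).val : ℝ) / q ≤ ‖(ZMod.stdAddChar v : ℂ) - 1‖ := by
  have hq0 : (0 : ℝ) < q := by exact_mod_cast NeZero.pos q
  have : NeZero v := ⟨hv⟩
  have hneg : ((-v).val : ℝ) = q - v.val := by
    rw [ZMod.val_neg_of_ne_zero, Nat.cast_sub (ZMod.val_lt v).le]
  have hlt : (v.val : ℝ) < q := by exact_mod_cast ZMod.val_lt v
  have hval0 : (0 : ℝ) ≤ v.val := Nat.cast_nonneg _
  have h1 : (ZMod.stdAddChar v : ℂ) =
      Complex.exp (Complex.I * ((2 * Real.pi * (v.val / q) : ℝ) : ℂ)) := by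
    have := ZMod.stdAddChar_coe (N := q) (v.val : ℤ)
    rw [Int.cast_natCast, ZMod.natCast_zmod_val] at this
    rw [this]
    congr 1
    push_cast
    ring
  rw [h1, Complex.norm_exp_I_mul_ofReal_sub_one, norm_mul, Real.norm_two, hneg]
  have hpi := Real.pi_pos
  have h2 : 2 * Real.pi * ((v.val : ℝ) / q) / 2 = Real.pi * (v.val / q) := by ring
  rw [h2]
  refine le_trans ?_ (mul_le_mul_of_nonneg_left (Real.le_norm_self _) zero_le_two)
  have hx0 : 0 ≤ (v.val : ℝ) / q := by positivity
  rcases le_total ((v.val : ℝ) / q) (1 / 2) with h | h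
  · have := Real.mul_le_sin (x := Real.pi * (v.val / q)) (by positivity) (by nlinarith)
    calc _ ≤ 4 * (v.val : ℝ) / q := by gcongr; exact min_le_left _ _
      _ = 2 * (2 / Real.pi * (Real.pi * (v.val / q))) := by field_simp; ring
      _ ≤ _ := by linarith
  · have hx1 : (v.val : ℝ) / q ≤ 1 := (div_le_one hq0).mpr hlt.le
    have := Real.mul_le_sin (x := Real.pi - Real.pi * (v.val / q)) (by nlinarith) (by nlinarith)
    rw [Real.sin_pi_sub] at this
    calc _ ≤ 4 * ((q : ℝ) - v.val) / q := by gcongr; exact min_le_right _ _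
      _ = 2 * (2 / Real.pi * (Real.pi - Real.pi * (v.val / q))) := by field_simp; ring
      _ ≤ _ := by linarith

lemma sum_inv_val_sq_le :
    ∑ v ∈ Finset.univ.erase (0 : ZMod q), ((v.val : ℝ) ^ 2)⁻¹ ≤ 2 := by
  have h : ∑ v ∈ Finset.univ.erase (0 : ZMod q), ((v.val : ℝ) ^ 2)⁻¹ =
      ∑ j ∈ Finset.Ioo 0 q, ((j : ℝ) ^ 2)⁻¹ := by
    refine Finset.sum_nbij' ZMod.val (fun j => (j : ZMod q)) ?_ ?_ ?_ ?_ ?_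
    · intro v hv
      simp only [Finset.mem_erase, Finset.mem_univ, and_true] at hv
      simp [Finset.mem_Ioo, ZMod.val_lt, Nat.pos_iff_ne_zero, hv]
    · intro j hj
      rw [Finset.mem_Ioo] at hj
      simp only [Finset.mem_erase, Finset.mem_univ, and_true]
      intro h0
      rw [ZMod.natCast_eq_zero_iff] at h0
      exact absurd (Nat.le_of_dvd hj.1 h0) (by omega)
    · intro v _
      simp
    · intro j hj
      rw [Finset.mem_Ioo] at hj
      exact ZMod.val_cast_of_lt hj.2
    · intro v _
      rfl
  rw [h]
  have := sum_Ioo_inv_sq_le (α := ℝ) 0 q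
  simpa using this

lemma sum_inv_norm_stdAddChar_sub_one_sq_le :
    ∑ v ∈ Finset.univ.erase (0 : ZMod q), (‖(ZMod.stdAddChar v : ℂ) - 1‖ ^ 2)⁻¹ ≤ q ^ 2 / 4 := by
  have hq0 : (0 : ℝ) < q := by exact_mod_cast NeZero.pos q
  have hpt : ∀ v ∈ Finset.univ.erase (0 : ZMod q), (‖(ZMod.stdAddChar v : ℂ) - 1‖ ^ 2)⁻¹ ≤
      (q : ℝ) ^ 2 / 16 * (((v.val : ℝ) ^ 2)⁻¹ + (((-v).val : ℝ) ^ 2)⁻¹) := by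
    intro v hv
    simp only [Finset.mem_erase, Finset.mem_univ, and_true] at hv
    have hv1 : (0 : ℝ) < v.val := by
      exact_mod_cast Nat.pos_of_ne_zero ((ZMod.val_ne_zero v).mpr hv)
    have hv2 : (0 : ℝ) < (-v).val := by
      exact_mod_cast Nat.pos_of_ne_zero ((ZMod.val_ne_zero (-v)).mpr (neg_ne_zero.mpr hv))
    have hm : 0 < min (v.val : ℝ) ((-v).val : ℝ) := lt_min hv1 hv2
    have h1 := le_norm_stdAddChar_sub_one hv
    calc (‖(ZMod.stdAddChar v : ℂ) - 1‖ ^ 2)⁻¹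
        ≤ ((4 * min (v.val : ℝ) ((-v).val : ℝ) / q) ^ 2)⁻¹ := by gcongr
      _ = (q : ℝ) ^ 2 / 16 * ((min (v.val : ℝ) ((-v).val : ℝ)) ^ 2)⁻¹ := by
        field_simp
        norm_num
      _ ≤ _ := by
        gcongr
        rcases min_choice (v.val : ℝ) ((-v).val : ℝ) with h | h <;> rw [h]
        · exact le_add_of_nonneg_right (by positivity)
        · exact le_add_of_nonneg_left (by positivity)
  have hneg : ∑ v ∈ Finset.univ.erase (0 : ZMod q), (((-v).val : ℝ) ^ 2)⁻¹ =
      ∑ v ∈ Finset.univ.erase (0 : ZMod q), ((v.val : ℝ) ^ 2)⁻¹ :=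
    Finset.sum_nbij' (fun v => -v) (fun v => -v) (by simp) (by simp) (by simp) (by simp) (by simp)
  refine (Finset.sum_le_sum hpt).trans ?_
  rw [← Finset.mul_sum, Finset.sum_add_distrib, hneg]
  have := sum_inv_val_sq_le (q := q)
  have hqq : 0 ≤ (q : ℝ) ^ 2 := by positivity
  nlinarith

/-- A quadratic exponential sum with a slowly varying weight `F` equals the mean of the quadratic
phase times the sum of the weight, up to an error governed by the second differences of `F`. -/
lemma norm_quadratic_tsum_sub_le (hq : Odd q) {b : ZMod q} (hb : IsUnit b) (k : ZMod q)
    {F : ℤ → ℂ} (hF : Summable F) :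
    ‖∑' l : ℤ, ZMod.stdAddChar (b * (l : ZMod q) ^ 2 + k * (l : ZMod q)) * F l -
        (q : ℂ)⁻¹ * quadGauss b k * ∑' l, F l‖ ≤
      (√q)⁻¹ * (q ^ 2 / 4) * ∑' l : ℤ, ‖F (l + 2) - 2 * F (l + 1) + F l‖ := by
  have hq0 : (0 : ℝ) < q := by exact_mod_cast NeZero.pos q
  set Φ : ZMod q → ℂ := fun r => ZMod.stdAddChar (b * r ^ 2 + k * r) with hΦ
  set T : ZMod q → ℂ := fun v => ∑' l : ℤ, ZMod.stdAddChar (v * (l : ZMod q)) * F l with hT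
  have hsum (v : ZMod q) : Summable fun l : ℤ => ZMod.stdAddChar (v * (l : ZMod q)) * F l := by
    refine Summable.of_norm_bounded hF.norm fun l => ?_
    rw [norm_mul, norm_stdAddChar, one_mul]
  have hinv (r : ZMod q) : Φ r = (q : ℂ)⁻¹ * ∑ v, ZMod.dft Φ v * ZMod.stdAddChar (v * r) := by
    have h1 : ZMod.dft.symm (ZMod.dft Φ) r = Φ r := by rw [LinearEquiv.symm_apply_apply]
    rw [← h1, ZMod.invDFT_apply, smul_eq_mul]
    congr 1
    exact Finset.sum_congr rfl fun v _ => by rw [smul_eq_mul, mul_comm]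
  have h1 : ∑' l : ℤ, ZMod.stdAddChar (b * (l : ZMod q) ^ 2 + k * (l : ZMod q)) * F l =
      (q : ℂ)⁻¹ * ∑ v, ZMod.dft Φ v * T v := by
    have hl (l : ℤ) : ZMod.stdAddChar (b * (l : ZMod q) ^ 2 + k * (l : ZMod q)) * F l =
        (q : ℂ)⁻¹ * ∑ v, ZMod.dft Φ v * (ZMod.stdAddChar (v * (l : ZMod q)) * F l) := by
      have := hinv l
      simp only [hΦ] at this ⊢
      rw [this, mul_assoc, Finset.sum_mul]
      simp only [mul_assoc]
    simp only [hl]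
    rw [tsum_mul_left, Summable.tsum_finsetSum fun v _ => (hsum v).mul_left _]
    simp only [tsum_mul_left, hT]
  have h2 : ZMod.dft Φ 0 = quadGauss b k := by rw [ZMod.dft_apply_zero, quadGauss]
  have h3 : T 0 = ∑' l, F l := by simp [hT]
  rw [h1, ← Finset.add_sum_erase _ _ (Finset.mem_univ (0 : ZMod q)), h2, h3, mul_add, ← mul_assoc,
    add_sub_cancel_left]
  set B := ∑' l : ℤ, ‖F (l + 2) - 2 * F (l + 1) + F l‖ with hB
  have hB0 : 0 ≤ B := tsum_nonneg fun _ => norm_nonneg _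
  have hTv : ∀ v ∈ Finset.univ.erase (0 : ZMod q),
      ‖ZMod.dft Φ v * T v‖ ≤ √q * ((‖(ZMod.stdAddChar v : ℂ) - 1‖ ^ 2)⁻¹ * B) := by
    intro v hv
    simp only [Finset.mem_erase, Finset.mem_univ, and_true] at hv
    rw [norm_mul, norm_dft_quadratic hq hb]
    have hne : (ZMod.stdAddChar v : ℂ) - 1 ≠ 0 := by
      rw [sub_ne_zero, ← AddChar.map_zero_eq_one (ZMod.stdAddChar (N := q))]
      exact fun h => hv (ZMod.injective_stdAddChar h)
    gcongr
    rw [le_inv_mul_iff₀ (by positivity)]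
    exact norm_sq_mul_norm_tsum_le hF v
  rw [norm_mul, norm_inv, Complex.norm_natCast]
  calc (q : ℝ)⁻¹ * ‖∑ v ∈ Finset.univ.erase (0 : ZMod q), ZMod.dft Φ v * T v‖
      ≤ (q : ℝ)⁻¹ * (√q * ((q ^ 2 / 4) * B)) := by
        gcongr
        refine (norm_sum_le_of_le _ hTv).trans ?_
        rw [← Finset.mul_sum, ← Finset.sum_mul]
        gcongr
        exact sum_inv_norm_stdAddChar_sub_one_sq_le
    _ = ((q : ℝ)⁻¹ * √q) * (q ^ 2 / 4) * B := by ring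
    _ = _ := by
        congr 2
        nth_rewrite 1 [← Real.sq_sqrt hq0.le]
        have : 0 < √(q : ℝ) := Real.sqrt_pos.mpr hq0
        field_simp

end Gauss

/-! ### Second differences of a modulated cutoff -/

/-- A second difference is bounded by the second derivative. -/
lemma norm_second_difference_le {f f' f'' : ℝ → ℂ} (hf : ∀ x, HasDerivAt f (f' x) x)
    (hf' : ∀ x, HasDerivAt f' (f'' x) x) {M : ℝ} (hM : ∀ x, ‖f'' x‖ ≤ M) (x h : ℝ) :
    ‖f (x + 2 * h) - 2 * f (x + h) + f x‖ ≤ M * |h| ^ 2 := by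
  have h1 (y : ℝ) : ‖f' (y + h) - f' y‖ ≤ M * |h| := by
    have := convex_univ.norm_image_sub_le_of_norm_hasDerivWithin_le (f := f') (f' := f'') (C := M)
      (fun x _ => (hf' x).hasDerivWithinAt) (fun x _ => hM x) (Set.mem_univ y)
      (Set.mem_univ (y + h))
    simpa using this
  have hg (y : ℝ) : HasDerivAt (fun y => f (y + h) - f y) (f' (y + h) - f' y) y :=
    ((hf (y + h)).comp_add_const y h).sub (hf y)
  have := convex_univ.norm_image_sub_le_of_norm_hasDerivWithin_le (f := fun y => f (y + h) - f y)
    (C := M * |h|) (fun x _ => (hg x).hasDerivWithinAt) (fun x _ => h1 x) (Set.mem_univ x)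
    (Set.mem_univ (x + h))
  have h2 : f (x + 2 * h) - 2 * f (x + h) + f x = (f (x + h + h) - f (x + h)) - (f (x + h) - f x) :=
    by
      rw [show x + 2 * h = x + h + h by ring]
      ring
  rw [h2]
  refine this.trans (le_of_eq ?_)
  rw [add_sub_cancel_left, Real.norm_eq_abs]
  ring

lemma hasDerivAt_e_mul (u y : ℝ) :
    HasDerivAt (fun y : ℝ => e (u * y)) (2 * Real.pi * u * Complex.I * e (u * y)) y := by
  have h1 : HasDerivAt (fun y : ℝ => (2 * Real.pi * (u * y : ℝ) * Complex.I : ℂ))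
      (2 * Real.pi * u * Complex.I) y := by
    have := ((((hasDerivAt_id y).const_mul u).ofReal_comp).const_mul
      (2 * Real.pi : ℂ)).mul_const Complex.I
    simpa using this
  exact h1.cexp.congr_deriv (mul_comm _ _)

/-- A smooth cutoff which is `1` on `[-1, 1]` and `0` outside `[-2, 2]`. -/
noncomputable def cutoff : ContDiffBump (0 : ℝ) := ⟨1, 2, one_pos, one_lt_two⟩

lemma cutoff_eq_zero {y : ℝ} (hy : 2 < |y|) : cutoff y = 0 :=
  cutoff.zero_of_le_dist (by simpa [cutoff] using hy.le)

lemma cutoff_eq_one {y : ℝ} (hy : |y| ≤ 1) : cutoff y = 1 :=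
  cutoff.one_of_mem_closedBall (by simpa [cutoff] using hy)

lemma exists_bound_cutoff_deriv : ∃ M : ℝ, 0 < M ∧ (∀ y, |deriv cutoff y| ≤ M) ∧
    ∀ y, |deriv (deriv cutoff) y| ≤ M := by
  have hs : HasCompactSupport (cutoff : ℝ → ℝ) := cutoff.hasCompactSupport
  have hd : ContDiff ℝ 2 (cutoff : ℝ → ℝ) := cutoff.contDiff
  have hd1 : ContDiff ℝ 1 (deriv (cutoff : ℝ → ℝ)) := hd.deriv'
  have hd2 : Continuous (deriv (deriv (cutoff : ℝ → ℝ))) := hd1.continuous_deriv_one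
  obtain ⟨M₁, h₁⟩ := hs.deriv.exists_bound_of_continuous hd1.continuous
  obtain ⟨M₂, h₂⟩ := hs.deriv.deriv.exists_bound_of_continuous hd2
  exact ⟨max 1 (max M₁ M₂), by positivity,
    fun y => (h₁ y).trans ((le_max_left _ _).trans (le_max_right _ _)),
    fun y => (h₂ y).trans ((le_max_right _ _).trans (le_max_right _ _))⟩

/-- The sequence `l ↦ χ(δ l) e(u δ l)`, where `χ` is the cutoff. -/
noncomputable def modulated (δ u : ℝ) (l : ℤ) : ℂ := (cutoff (δ * l) : ℂ) * e (u * (δ * l))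

/-- Each difference of the modulated cutoff gains `δ` and costs at most a factor of size
`1 + |u|`. -/
lemma exists_bound_second_difference_modulated : ∃ M : ℝ, 0 < M ∧ ∀ (δ u : ℝ) (l : ℤ),
    ‖modulated δ u (l + 2) - 2 * modulated δ u (l + 1) + modulated δ u l‖ ≤
      M * (1 + u ^ 2) * δ ^ 2 := by
  obtain ⟨M, hM, h₁, h₂⟩ := exists_bound_cutoff_deriv
  refine ⟨M * 2 * (1 + 4 * Real.pi ^ 2) + 4 * Real.pi ^ 2, by positivity, fun δ u l => ?_⟩
  have hd : ContDiff ℝ 2 (cutoff : ℝ → ℝ) := cutoff.contDiff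
  have hd1 : ContDiff ℝ 1 (deriv (cutoff : ℝ → ℝ)) := hd.deriv'
  have hc (y : ℝ) : HasDerivAt (fun y => (cutoff y : ℂ)) ((deriv cutoff y : ℝ) : ℂ) y :=
    ((hd.differentiable (by norm_num) y).hasDerivAt).ofReal_comp
  have hc' (y : ℝ) : HasDerivAt (fun y => ((deriv cutoff y : ℝ) : ℂ)) ((deriv (deriv cutoff) y : ℝ) : ℂ) y :=
    ((hd1.differentiable (by norm_num) y).hasDerivAt).ofReal_comp
  obtain ⟨κ, hκ⟩ : ∃ κ : ℂ, κ = 2 * Real.pi * u * Complex.I := ⟨_, rfl⟩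
  have hκn : ‖κ‖ = 2 * Real.pi * |u| := by
    simp [hκ, abs_of_pos Real.pi_pos]
  have key := norm_second_difference_le (f := fun y => (cutoff y : ℂ) * e (u * y))
    (f' := fun y => (((deriv cutoff y : ℝ) : ℂ) + κ * cutoff y) * e (u * y))
    (f'' := fun y => (((deriv (deriv cutoff) y : ℝ) : ℂ) + 2 * κ * (deriv cutoff y : ℝ) + κ ^ 2 * cutoff y) *
      e (u * y))
    (fun y => ((hc y).mul (hasDerivAt_e_mul u y)).congr_deriv (by rw [← hκ]; ring))
    (fun y => (((hc' y).add ((hc y).const_mul κ)).mul (hasDerivAt_e_mul u y)).congr_deriv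
      (by rw [← hκ, Pi.add_apply]; ring))
    (M := (M * 2 * (1 + 4 * Real.pi ^ 2) + 4 * Real.pi ^ 2) * (1 + u ^ 2)) (fun y => ?_) (δ * l) δ
  · rw [sq_abs] at key
    refine le_trans (le_of_eq ?_) key
    simp only [modulated]
    have h1 : δ * ((l + 1 : ℤ) : ℝ) = δ * l + δ := by push_cast; ring
    have h2 : δ * ((l + 2 : ℤ) : ℝ) = δ * l + 2 * δ := by push_cast; ring
    rw [h1, h2]
  · rw [norm_mul, norm_e, mul_one]
    have hb : |(cutoff y : ℝ)| ≤ 1 := by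
      rw [abs_of_nonneg cutoff.nonneg]
      exact cutoff.le_one
    calc _ ≤ ‖((deriv (deriv cutoff) y : ℝ) : ℂ)‖ + ‖2 * κ * (deriv cutoff y : ℝ)‖ + ‖κ ^ 2 * cutoff y‖ :=
          norm_add₃_le
      _ ≤ M + 2 * (2 * Real.pi * |u|) * M + (2 * Real.pi * |u|) ^ 2 * 1 := by
          rw [norm_mul (2 * κ), norm_mul 2 κ, norm_mul (κ ^ 2), norm_pow, hκn, Complex.norm_real, Complex.norm_real,
            Complex.norm_real, Complex.norm_ofNat]
          gcongr
          · exact h₂ y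
          · exact h₁ y
          · exact hb
      _ ≤ _ := by
          have h3 := sq_nonneg (2 * Real.pi * |u| - 1)
          have h4 : M * (2 * (2 * Real.pi * |u|)) ≤ M * (1 + 4 * Real.pi ^ 2 * u ^ 2) := by
            gcongr
            nlinarith [sq_abs u]
          rw [mul_pow, mul_pow, sq_abs]
          have h5 : 0 ≤ M * Real.pi ^ 2 := by positivity
          have h6 : 0 ≤ M * u ^ 2 := by positivity
          have h7 : 0 ≤ Real.pi ^ 2 := by positivity
          have h8 : 0 ≤ M * Real.pi ^ 2 * u ^ 2 := by positivity
          nlinarith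

lemma mem_Icc_floor {s : ℝ} {l : ℤ} : l ∈ Finset.Icc (-⌊s⌋) ⌊s⌋ ↔ |(l : ℝ)| ≤ s := by
  rw [Finset.mem_Icc, ← abs_le, Int.le_floor, Int.cast_abs]

lemma card_Icc_floor_le {s : ℝ} (hs : 0 ≤ s) :
    ((Finset.Icc (-⌊s⌋) ⌊s⌋).card : ℝ) ≤ 2 * s + 1 := by
  have := card_latticeCube_le (d := 1) hs
  simpa [latticeCube] using this

lemma modulated_eq_zero {δ : ℝ} (hδ : 0 < δ) (u : ℝ) {l : ℤ} (hl : 2 / δ < |(l : ℝ)|) :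
    modulated δ u l = 0 := by
  rw [div_lt_iff₀ hδ] at hl
  rw [modulated, cutoff_eq_zero, Complex.ofReal_zero, zero_mul]
  rw [abs_mul, abs_of_pos hδ]
  linarith

lemma tsum_modulated_mul {δ : ℝ} (hδ : 0 < δ) (u : ℝ) (a : ℤ → ℂ) :
    ∑' l, a l * modulated δ u l = ∑ l ∈ Finset.Icc (-⌊2 / δ⌋) ⌊2 / δ⌋, a l * modulated δ u l := by
  refine tsum_eq_sum fun l hl => ?_
  rw [mem_Icc_floor, not_le] at hl
  rw [modulated_eq_zero hδ u hl, mul_zero]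

lemma summable_modulated {δ : ℝ} (hδ : 0 < δ) (u : ℝ) : Summable (modulated δ u) := by
  refine summable_of_ne_finset_zero (s := Finset.Icc (-⌊2 / δ⌋) ⌊2 / δ⌋) fun l hl => ?_
  rw [mem_Icc_floor, not_le] at hl
  exact modulated_eq_zero hδ u hl

lemma norm_modulated_le (δ u : ℝ) (l : ℤ) : ‖modulated δ u l‖ ≤ 1 := by
  rw [modulated, norm_mul, norm_e, mul_one, Complex.norm_real, Real.norm_of_nonneg cutoff.nonneg]
  exact cutoff.le_one

lemma norm_tsum_modulated_le {δ : ℝ} (hδ : 0 < δ) (hδ1 : δ ≤ 1) (u : ℝ) :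
    ‖∑' l, modulated δ u l‖ ≤ 5 / δ := by
  have h1 := tsum_modulated_mul hδ u 1
  simp only [Pi.one_apply, one_mul] at h1
  rw [h1]
  refine (norm_sum_le_of_le _ fun l _ => norm_modulated_le δ u l).trans ?_
  rw [Finset.sum_const, nsmul_eq_mul, mul_one]
  refine (card_Icc_floor_le (by positivity)).trans ?_
  rw [le_div_iff₀ hδ]
  have : 2 / δ * δ = 2 := by field_simp
  linarith

lemma exists_bound_tsum_second_difference : ∃ M : ℝ, 0 < M ∧ ∀ {δ : ℝ}, 0 < δ → δ ≤ 1 → ∀ u : ℝ,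
    ∑' l : ℤ, ‖modulated δ u (l + 2) - 2 * modulated δ u (l + 1) + modulated δ u l‖ ≤
      M * (1 + u ^ 2) * δ := by
  obtain ⟨M, hM, h⟩ := exists_bound_second_difference_modulated
  refine ⟨9 * M, by positivity, fun {δ} hδ hδ1 u => ?_⟩
  rw [tsum_eq_sum (s := Finset.Icc (-⌊4 / δ⌋) ⌊4 / δ⌋)]
  · refine (Finset.sum_le_card_nsmul _ _ _ fun l _ => h δ u l).trans ?_
    rw [nsmul_eq_mul]
    calc _ ≤ (9 / δ) * (M * (1 + u ^ 2) * δ ^ 2) := by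
          gcongr
          refine (card_Icc_floor_le (by positivity)).trans ?_
          rw [le_div_iff₀ hδ]
          have : 4 / δ * δ = 4 := by field_simp
          linarith
      _ = _ := by field_simp
  · intro l hl
    rw [mem_Icc_floor, not_le] at hl
    have h2 : 2 ≤ 2 / δ := by rw [le_div_iff₀ hδ]; linarith
    have h4 : 4 / δ = 2 / δ + 2 / δ := by ring
    have hz (j : ℤ) (hj : |(j : ℝ)| ≤ 2) : modulated δ u (l + j) = 0 := by
      refine modulated_eq_zero hδ u ?_
      have := abs_sub_abs_le_abs_sub (l : ℝ) (-(j : ℝ))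
      rw [abs_neg, sub_neg_eq_add] at this
      push_cast
      linarith
    have hz0 := hz 0 (by norm_num)
    rw [add_zero] at hz0
    rw [hz 2 (by norm_num), hz 1 (by norm_num), hz0]
    simp

/-- The one-dimensional estimate: a quadratic exponential sum over an interval of length `1 / δ`
that is long compared with `q` is the product of the normalised Gauss sum and the sum of the
weights, up to a relative error `(q δ)²`. -/
lemma exists_bound_quadratic_modulated : ∃ M : ℝ, 0 < M ∧ ∀ {δ : ℝ}, 0 < δ → δ ≤ 1 → ∀ u : ℝ,
    ∀ {q : ℕ} [NeZero q], Odd q → ∀ {b : ZMod q}, IsUnit b → ∀ k : ZMod q,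
    ‖∑' l : ℤ, ZMod.stdAddChar (b * (l : ZMod q) ^ 2 + k * (l : ZMod q)) * modulated δ u l -
      (q : ℂ)⁻¹ * quadGauss b k * ∑' l, modulated δ u l‖ ≤
      (√q)⁻¹ * δ⁻¹ * (M * (q * δ) ^ 2) * (1 + u ^ 2) := by
  obtain ⟨M, hM, h⟩ := exists_bound_tsum_second_difference
  refine ⟨M / 4, by positivity, fun {δ} hδ hδ1 u {q} _ hq {b} hb k => ?_⟩
  refine (norm_quadratic_tsum_sub_le hq hb k (summable_modulated hδ u)).trans ?_
  calc _ ≤ (√q)⁻¹ * (q ^ 2 / 4) * (M * (1 + u ^ 2) * δ) := by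
        gcongr
        exact h hδ hδ1 u
    _ = _ := by
        field_simp

/-! ### Quadratic exponential sums in several variables -/

lemma e_sum {ι : Type*} (s : Finset ι) (f : ι → ℝ) : e (∑ i ∈ s, f i) = ∏ i ∈ s, e (f i) := by
  classical
  induction s using Finset.induction_on with
  | empty => simp [e]
  | insert i s hi ih => rw [Finset.sum_insert hi, Finset.prod_insert hi, e_add, ih]

/-- Two products with comparable factors that agree up to the relative error `ε`. -/
lemma norm_prod_sub_prod_le_of_le {ι : Type*} (s : Finset ι) {x y : ι → ℂ} {B : ι → ℝ} {ε : ℝ}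
    (hx : ∀ i, ‖x i‖ ≤ B i) (hy : ∀ i, ‖y i‖ ≤ B i) (hxy : ∀ i, ‖x i - y i‖ ≤ ε * B i) :
    ‖∏ i ∈ s, x i - ∏ i ∈ s, y i‖ ≤ s.card * ε * ∏ i ∈ s, B i := by
  classical
  have hB (i : ι) : 0 ≤ B i := (norm_nonneg _).trans (hx i)
  induction s using Finset.induction_on with
  | empty => simp
  | insert i s hi ih =>
    rw [Finset.prod_insert hi, Finset.prod_insert hi, Finset.prod_insert hi,
      Finset.card_insert_of_notMem hi]
    have h1 : x i * ∏ j ∈ s, x j - y i * ∏ j ∈ s, y j =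
        x i * (∏ j ∈ s, x j - ∏ j ∈ s, y j) + (x i - y i) * ∏ j ∈ s, y j := by ring
    have h2 : ‖∏ j ∈ s, y j‖ ≤ ∏ j ∈ s, B j := by
      rw [norm_prod]
      exact Finset.prod_le_prod (fun _ _ => norm_nonneg _) fun j _ => hy j
    rw [h1]
    refine (norm_add_le _ _).trans ?_
    rw [norm_mul, norm_mul]
    calc _ ≤ B i * (s.card * ε * ∏ j ∈ s, B j) + ε * B i * ∏ j ∈ s, B j := by
          have h3 := mul_le_mul (hx i) ih (norm_nonneg _) (hB i)
          have h4 := mul_le_mul (hxy i) h2 (norm_nonneg _) ((norm_nonneg _).trans (hxy i))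
          exact add_le_add h3 h4
      _ = _ := by
          push_cast
          ring

section Several

variable {d : ℕ}

/-- A real Schwartz function, regarded as a complex one. -/
noncomputable def toComplex (ψ : 𝓢(EuclideanSpace ℝ (Fin d), ℝ)) :
    𝓢(EuclideanSpace ℝ (Fin d), ℂ) := SchwartzMap.postcompCLM Complex.ofRealCLM ψ

lemma toComplex_apply (ψ : 𝓢(EuclideanSpace ℝ (Fin d), ℝ)) (y : EuclideanSpace ℝ (Fin d)) :
    toComplex ψ y = (ψ y : ℂ) := rfl

lemma eq_integral_fourier (ψ : 𝓢(EuclideanSpace ℝ (Fin d), ℝ)) (y : EuclideanSpace ℝ (Fin d)) :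
    (ψ y : ℂ) = ∫ ζ, (𝓕 (toComplex ψ)) ζ * e (inner ℝ ζ y) := by
  rw [← fourierInv_eq_integral_e, ← SchwartzMap.fourierInv_coe,
    FourierTransform.fourierInv_fourier_eq, toComplex_apply]

/-- Expanding `ψ` into characters turns a sum over the lattice into a superposition of products of
one-dimensional sums. -/
lemma sum_lattice_eq_integral {ψ : 𝓢(EuclideanSpace ℝ (Fin d), ℝ)} (hψ : IsCutoff (1 / 20) ψ)
    {δ : ℝ} (hδ : 0 < δ) (w : EuclideanSpace ℝ (Fin d)) (a : Fin d → ℤ → ℂ) :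
    Integrable (fun ζ => (𝓕 (toComplex ψ)) ζ * ∏ j, ∑' k, a j k * modulated δ (ζ j + w j) k) ∧
    ∑ l ∈ latticeCube d (2 / δ), (ψ (δ • latticePoint l) : ℂ) * e (inner ℝ w (δ • latticePoint l)) *
        ∏ j, a j (l j) =
      ∫ ζ, (𝓕 (toComplex ψ)) ζ * ∏ j, ∑' k, a j k * modulated δ (ζ j + w j) k := by
  have hexp (ζ : EuclideanSpace ℝ (Fin d)) : (𝓕 (toComplex ψ)) ζ *
      ∏ j, ∑' k, a j k * modulated δ (ζ j + w j) k = ∑ l ∈ latticeCube d (2 / δ),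
        (e (inner ℝ w (δ • latticePoint l)) * ∏ j, a j (l j) * (cutoff (δ * l j) : ℂ)) *
          ((𝓕 (toComplex ψ)) ζ * e (inner ℝ ζ (δ • latticePoint l))) := by
    simp only [tsum_modulated_mul hδ]
    rw [Finset.prod_univ_sum, Finset.mul_sum]
    refine Finset.sum_congr rfl fun l _ => ?_
    have h1 : e (inner ℝ w (δ • latticePoint l)) * e (inner ℝ ζ (δ • latticePoint l)) =
        ∏ j, e ((ζ j + w j) * (δ * l j)) := by
      rw [← e_add, ← e_sum]
      congr 1
      simp only [PiLp.inner_apply, latticePoint, PiLp.smul_apply, smul_eq_mul, RCLike.inner_apply,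
        conj_trivial]
      rw [← Finset.sum_add_distrib]
      refine Finset.sum_congr rfl fun j _ => ?_
      ring
    have h2 : ∏ j, a j (l j) * modulated δ (ζ j + w j) (l j) =
        (∏ j, a j (l j) * (cutoff (δ * l j) : ℂ)) * ∏ j, e ((ζ j + w j) * (δ * l j)) := by
      rw [← Finset.prod_mul_distrib]
      exact Finset.prod_congr rfl fun j _ => by rw [modulated]; ring
    rw [h2, ← h1]
    ring
  have hint (l : Fin d → ℤ) : Integrable fun ζ =>
      (e (inner ℝ w (δ • latticePoint l)) * ∏ j, a j (l j) * (cutoff (δ * l j) : ℂ)) *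
          ((𝓕 (toComplex ψ)) ζ * e (inner ℝ ζ (δ • latticePoint l))) :=
    (integrable_mul_phase (by fun_prop)).const_mul _
  simp only [hexp]
  refine ⟨integrable_finsetSum _ fun l _ => hint l, ?_⟩
  rw [integral_finsetSum _ fun l _ => hint l]
  refine Finset.sum_congr rfl fun l _ => ?_
  rw [integral_const_mul, ← eq_integral_fourier, Finset.prod_mul_distrib]
  by_cases h0 : ψ (δ • latticePoint l) = 0
  · simp [h0]
  · -- the product of the cutoffs is `1` on the support of `ψ`
    have h1 : ∏ j, (cutoff (δ * l j) : ℂ) = 1 := by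
      refine Finset.prod_eq_one fun j _ => ?_
      rw [cutoff_eq_one, Complex.ofReal_one]
      have h2 : ‖δ • latticePoint l‖ ≤ 1 / 20 := by
        by_contra h
        exact h0 (hψ.support _ (not_le.mp h))
      rw [norm_smul, Real.norm_of_nonneg hδ.le] at h2
      rw [abs_mul, abs_of_pos hδ]
      have := mul_le_mul_of_nonneg_left (abs_coord_le_norm_latticePoint l j) hδ.le
      linarith
    rw [h1]
    ring

lemma integrable_one_add_norm_pow_mul (Φ : 𝓢(EuclideanSpace ℝ (Fin d), ℂ)) (k : ℕ) :
    Integrable fun ζ => (1 + ‖ζ‖ ^ k) * ‖Φ ζ‖ := by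
  have := Φ.integrable.norm.add (Φ.integrable_pow_mul volume k)
  refine this.congr (.of_forall fun ζ => ?_)
  simp only [Pi.add_apply]
  ring

lemma prod_one_add_sq_le {w : EuclideanSpace ℝ (Fin d)} (hw : ‖w‖ ≤ 3)
    (ζ : EuclideanSpace ℝ (Fin d)) :
    ∏ j, (1 + (ζ j + w j) ^ 2) ≤ 19 ^ d * 2 ^ (d - 1) * (1 + ‖ζ‖ ^ (2 * d)) := by
  have h1 (j : Fin d) : 1 + (ζ j + w j) ^ 2 ≤ 19 * (1 + ‖ζ‖ ^ 2) := by
    have h2 := (PiLp.norm_apply_le w j).trans hw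
    have h3 := PiLp.norm_apply_le ζ j
    rw [Real.norm_eq_abs] at h2 h3
    have h4 : w j ^ 2 ≤ 3 ^ 2 := sq_le_sq' (by linarith [(abs_le.mp h2).1]) (abs_le.mp h2).2
    have h5 : ζ j ^ 2 ≤ ‖ζ‖ ^ 2 := sq_le_sq' (by linarith [(abs_le.mp h3).1]) (abs_le.mp h3).2
    nlinarith [sq_nonneg (ζ j - w j), sq_nonneg ‖ζ‖]
  calc ∏ j, (1 + (ζ j + w j) ^ 2) ≤ ∏ _j : Fin d, (19 * (1 + ‖ζ‖ ^ 2)) :=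
        Finset.prod_le_prod (fun j _ => by positivity) fun j _ => h1 j
    _ = 19 ^ d * (1 + ‖ζ‖ ^ 2) ^ d := by simp [mul_pow]
    _ ≤ 19 ^ d * (2 ^ (d - 1) * (1 ^ d + (‖ζ‖ ^ 2) ^ d)) := by
        gcongr
        exact add_pow_le zero_le_one (by positivity) d
    _ = _ := by
        rw [one_pow, ← pow_mul]
        ring

/-- The weighted lattice sum `∑ ψ(δ l) e(w ⬝ δ l) ∏ a_j(l_j)`. -/
noncomputable def latticeSum (ψ : 𝓢(EuclideanSpace ℝ (Fin d), ℝ)) (δ : ℝ)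
    (w : EuclideanSpace ℝ (Fin d)) (a : Fin d → ℤ → ℂ) : ℂ :=
  ∑ l ∈ latticeCube d (2 / δ), (ψ (δ • latticePoint l) : ℂ) * e (inner ℝ w (δ • latticePoint l)) *
    ∏ j, a j (l j)

/-- Weighted quadratic exponential sums over a region of diameter `1 / δ ≥ q` split, up to a small
error, into the normalised Gauss sums and the sum of the weights. -/
lemma exists_bound_latticeSum {ψ : 𝓢(EuclideanSpace ℝ (Fin d), ℝ)} (hψ : IsCutoff (1 / 20) ψ) :
    ∃ M : ℝ, 0 < M ∧ ∀ {δ : ℝ}, 0 < δ → δ ≤ 1 → ∀ {w : EuclideanSpace ℝ (Fin d)}, ‖w‖ ≤ 3 →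
    ∀ {q : ℕ} [NeZero q], Odd q → q * δ ≤ 1 → ∀ {b : ZMod q}, IsUnit b → ∀ k : Fin d → ZMod q,
    ‖latticeSum ψ δ w
        (fun j l => ZMod.stdAddChar (b * (l : ZMod q) ^ 2 + k j * (l : ZMod q))) -
      (∏ j, (q : ℂ)⁻¹ * quadGauss b (k j)) * latticeSum ψ δ w 1‖ ≤
      ((√q)⁻¹ * δ⁻¹) ^ d * (M * (q * δ) ^ 2) := by
  obtain ⟨M, hM, hbound⟩ := exists_bound_quadratic_modulated
  set I := ∫ ζ, (1 + ‖ζ‖ ^ (2 * d)) * ‖(𝓕 (toComplex ψ)) ζ‖ with hI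
  have hI0 : 0 ≤ I := integral_nonneg fun ζ => by positivity
  refine ⟨d * (M + 5) ^ d * (19 ^ d * 2 ^ (d - 1)) * I + 1, by positivity, ?_⟩
  intro δ hδ hδ1 w hw q _ hq hqδ b hb k
  have hq0 : (0 : ℝ) < q := by exact_mod_cast NeZero.pos q
  have hsq : 0 < √(q : ℝ) := Real.sqrt_pos.mpr hq0
  set a : Fin d → ℤ → ℂ :=
    fun j l => ZMod.stdAddChar (b * (l : ZMod q) ^ 2 + k j * (l : ZMod q)) with ha
  set γ : Fin d → ℂ := fun j => (q : ℂ)⁻¹ * quadGauss b (k j) with hγ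
  have hγn (j : Fin d) : ‖γ j‖ = (√q)⁻¹ := norm_inv_mul_quadGauss hq hb (k j)
  have h1 := sum_lattice_eq_integral hψ hδ w a
  have h2 := sum_lattice_eq_integral hψ hδ w fun j _ => γ j
  have h3 : (∏ j, γ j) * latticeSum ψ δ w 1 = ∑ l ∈ latticeCube d (2 / δ),
      (ψ (δ • latticePoint l) : ℂ) * e (inner ℝ w (δ • latticePoint l)) * ∏ j, γ j := by
    rw [latticeSum, Finset.mul_sum]
    refine Finset.sum_congr rfl fun l _ => ?_
    simp only [Pi.one_apply, Finset.prod_const_one]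
    ring
  rw [h3, latticeSum, h1.2, h2.2, ← integral_sub h1.1 h2.1]
  have hpt (ζ : EuclideanSpace ℝ (Fin d)) :
      ‖(𝓕 (toComplex ψ)) ζ * ∏ j, ∑' k, a j k * modulated δ (ζ j + w j) k -
        (𝓕 (toComplex ψ)) ζ * ∏ j, ∑' k, γ j * modulated δ (ζ j + w j) k‖ ≤
      (((√q)⁻¹ * δ⁻¹) ^ d * (d * (M + 5) ^ d * (19 ^ d * 2 ^ (d - 1))) * (q * δ) ^ 2) *
        ((1 + ‖ζ‖ ^ (2 * d)) * ‖(𝓕 (toComplex ψ)) ζ‖) := by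
    rw [← mul_sub, norm_mul]
    set B : Fin d → ℝ := fun j => (√q)⁻¹ * δ⁻¹ * (M + 5) * (1 + (ζ j + w j) ^ 2) with hB
    -- the one-dimensional estimate in each coordinate
    have hdiff (j : Fin d) : ‖∑' k, a j k * modulated δ (ζ j + w j) k -
        ∑' k, γ j * modulated δ (ζ j + w j) k‖ ≤ (√q)⁻¹ * δ⁻¹ * (M * (q * δ) ^ 2) *
          (1 + (ζ j + w j) ^ 2) := by
      rw [tsum_mul_left]
      exact hbound hδ hδ1 _ hq hb (k j)
    have hqδ2 : (q * δ) ^ 2 ≤ 1 := pow_le_one₀ (by positivity) hqδ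
    have hy0 (j : Fin d) : ‖∑' k, γ j * modulated δ (ζ j + w j) k‖ ≤
        (√q)⁻¹ * δ⁻¹ * 5 * (1 + (ζ j + w j) ^ 2) := by
      rw [tsum_mul_left, norm_mul, hγn]
      calc _ ≤ (√q)⁻¹ * (5 / δ) := by
            gcongr
            exact norm_tsum_modulated_le hδ hδ1 _
        _ = (√q)⁻¹ * δ⁻¹ * 5 * 1 := by ring
        _ ≤ _ := by
            gcongr
            exact le_add_of_nonneg_right (sq_nonneg _)
    -- `B j` bounds both factors, and `(q δ)²` is the relative error between them
    have hprod := norm_prod_sub_prod_le_of_le Finset.univ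
      (x := fun j => ∑' k, a j k * modulated δ (ζ j + w j) k)
      (y := fun j => ∑' k, γ j * modulated δ (ζ j + w j) k) (B := B) (ε := (q * δ) ^ 2)
      (fun j => ?_) (fun j => ?_) (fun j => ?_)
    · calc _ ≤ ‖(𝓕 (toComplex ψ)) ζ‖ * (d * (q * δ) ^ 2 * ∏ j, B j) := by
            gcongr
            simpa using hprod
        _ ≤ ‖(𝓕 (toComplex ψ)) ζ‖ * (d * (q * δ) ^ 2 * (((√q)⁻¹ * δ⁻¹ * (M + 5)) ^ d *
              (19 ^ d * 2 ^ (d - 1) * (1 + ‖ζ‖ ^ (2 * d))))) := by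
            rw [hB, Finset.prod_mul_distrib, Finset.prod_const, Finset.card_univ, Fintype.card_fin]
            gcongr
            exact prod_one_add_sq_le hw ζ
        _ = _ := by
            rw [mul_pow ((√q)⁻¹ * δ⁻¹)]
            ring
    · have h4 := norm_add_le (∑' k, a j k * modulated δ (ζ j + w j) k -
        ∑' k, γ j * modulated δ (ζ j + w j) k) (∑' k, γ j * modulated δ (ζ j + w j) k)
      rw [sub_add_cancel] at h4
      have h5 : (√q)⁻¹ * δ⁻¹ * (M * (q * δ) ^ 2) * (1 + (ζ j + w j) ^ 2) ≤
          (√q)⁻¹ * δ⁻¹ * (M * 1) * (1 + (ζ j + w j) ^ 2) := by gcongr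
      have h6 := hdiff j
      have h7 := hy0 j
      simp only [hB]
      linarith
    · refine (hy0 j).trans ?_
      simp only [hB]
      gcongr
      linarith
    · refine (hdiff j).trans ?_
      simp only [hB]
      have h8 : 0 ≤ (√q)⁻¹ * δ⁻¹ * (1 + (ζ j + w j) ^ 2) * (q * δ) ^ 2 := by positivity
      nlinarith
  refine (norm_integral_le_integral_norm _).trans ?_
  refine (integral_mono (h1.1.sub h2.1).norm
    ((integrable_one_add_norm_pow_mul _ _).const_mul _) hpt).trans ?_
  rw [integral_const_mul, ← hI]
  have h9 : 0 ≤ ((√q)⁻¹ * δ⁻¹) ^ d * (q * δ) ^ 2 := by positivity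
  nlinarith

end Several

/-! ### Riemann sums -/

section Riemann

variable {d : ℕ}

lemma mem_latticeCube_of_norm_le {δ : ℝ} (hδ : 0 < δ) {l : Fin d → ℤ}
    (h : ‖δ • latticePoint l‖ ≤ 1 / 20) : l ∈ latticeCube d (2 / δ) := by
  rw [mem_latticeCube]
  intro j
  rw [norm_smul, Real.norm_of_nonneg hδ.le] at h
  rw [le_div_iff₀ hδ]
  have := mul_le_mul_of_nonneg_left (abs_coord_le_norm_latticePoint l j) hδ.le
  linarith

/-- A cube of side `2 s` centred anywhere contains at least `(s / δ)^d` points of `δ ℤ^d`. -/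
lemma exists_lattice_near {δ s : ℝ} (hδ : 0 < δ) (hδs : δ ≤ s) (y : EuclideanSpace ℝ (Fin d)) :
    ∃ A : Finset (Fin d → ℤ), (s / δ) ^ d ≤ (A.card : ℝ) ∧
      ∀ l ∈ A, ‖δ • latticePoint l - y‖ ≤ d * s := by
  have hs : 0 < s := hδ.trans_le hδs
  refine ⟨Fintype.piFinset fun j => Finset.Icc ⌈(y j - s) / δ⌉ ⌊(y j + s) / δ⌋, ?_, ?_⟩
  · rw [Fintype.card_piFinset, Nat.cast_prod]
    have h1 : (s / δ) ^ d = ∏ _j : Fin d, (s / δ) := by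
      rw [Finset.prod_const, Finset.card_univ, Fintype.card_fin]
    rw [h1]
    refine Finset.prod_le_prod (fun _ _ => by positivity) fun j _ => ?_
    rw [Int.card_Icc]
    have h2 : ((⌊(y j + s) / δ⌋ + 1 - ⌈(y j - s) / δ⌉ : ℤ) : ℝ) ≤
        (((⌊(y j + s) / δ⌋ + 1 - ⌈(y j - s) / δ⌉).toNat : ℕ) : ℝ) := by
      exact_mod_cast Int.self_le_toNat _
    refine le_trans ?_ h2
    push_cast
    have h3 := Int.lt_floor_add_one ((y j + s) / δ)
    have h4 := Int.ceil_lt_add_one ((y j - s) / δ)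
    have h5 : (y j + s) / δ - (y j - s) / δ = s / δ + s / δ := by ring
    have h6 : 1 ≤ s / δ := (one_le_div hδ).mpr hδs
    linarith
  · intro l hl
    refine norm_le_of_coord_le hs.le fun j => ?_
    have h1 := Fintype.mem_piFinset.mp hl j
    rw [Finset.mem_Icc, Int.ceil_le, Int.le_floor, div_le_iff₀ hδ, le_div_iff₀ hδ] at h1
    simp only [latticePoint, PiLp.sub_apply, PiLp.smul_apply, smul_eq_mul]
    rw [abs_le]
    constructor <;> linarith [h1.1, h1.2]

/-- The sum over `δ ℤ^d` of a fixed nonnegative function has size `δ^{-d}`. -/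
lemma sameSize_riemann {g : EuclideanSpace ℝ (Fin d) → ℝ} (hg : Continuous g) (h0 : ∀ y, 0 ≤ g y)
    (hne : ∃ y, g y ≠ 0) (hsupp : ∀ y, g y ≠ 0 → ‖y‖ ≤ 1 / 20) :
    ∃ δ₀ : ℝ, 0 < δ₀ ∧ ∃ K : ℝ, 0 < K ∧ ∀ {δ : ℝ}, 0 < δ → δ ≤ δ₀ →
      SameSize K (∑ l ∈ latticeCube d (2 / δ), g (δ • latticePoint l)) (δ⁻¹ ^ d) := by
  obtain ⟨y₀, hy₀⟩ := hne
  have hy₀' : 0 < g y₀ := lt_of_le_of_ne (h0 _) hy₀.symm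
  have hcs : HasCompactSupport g := by
    refine HasCompactSupport.of_support_subset_isCompact
      (isCompact_closedBall (0 : EuclideanSpace ℝ (Fin d)) (1 / 20)) fun y hy => ?_
    simpa using hsupp y hy
  obtain ⟨B, hB⟩ := hcs.exists_bound_of_continuous hg
  have hB0 : 0 ≤ B := (norm_nonneg _).trans (hB 0)
  obtain ⟨r, hr, hnear⟩ := Metric.continuous_iff.mp hg y₀ (g y₀ / 2) (by positivity)
  set s := r / (d + 1) with hs
  have hs0 : 0 < s := by positivity
  have hds : d * s < r := by
    rw [hs, mul_div_assoc', div_lt_iff₀ (by positivity)]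
    nlinarith
  refine ⟨min s 1, by positivity, max (B * 5 ^ d) (g y₀ / 2 * s ^ d)⁻¹, by positivity, ?_⟩
  intro δ hδ hδ'
  have hδs := hδ'.trans (min_le_left _ _)
  have hδ1 := hδ'.trans (min_le_right _ _)
  refine sameSize_of_between (by positivity) (by positivity) ?_ ?_
  · obtain ⟨A, hA, hAy⟩ := exists_lattice_near hδ hδs y₀
    have hbig : ∀ l ∈ A, g y₀ / 2 ≤ g (δ • latticePoint l) := by
      intro l hl
      have h1 := hnear (δ • latticePoint l) (by
        rw [dist_eq_norm]
        exact (hAy l hl).trans_lt hds)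
      rw [Real.dist_eq] at h1
      linarith [(abs_lt.mp h1).1]
    have hsub : A ⊆ latticeCube d (2 / δ) := fun l hl =>
      mem_latticeCube_of_norm_le hδ (hsupp _ (by linarith [hbig l hl]))
    calc g y₀ / 2 * s ^ d * δ⁻¹ ^ d = g y₀ / 2 * (s / δ) ^ d := by
          rw [div_eq_mul_inv s δ, mul_pow]
          ring
      _ ≤ g y₀ / 2 * A.card := by gcongr
      _ = A.card • (g y₀ / 2) := by rw [nsmul_eq_mul, mul_comm]
      _ ≤ ∑ l ∈ A, g (δ • latticePoint l) := Finset.card_nsmul_le_sum _ _ _ hbig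
      _ ≤ _ := Finset.sum_le_sum_of_subset_of_nonneg hsub fun _ _ _ => h0 _
  · refine (Finset.sum_le_card_nsmul _ _ B fun l _ => (Real.le_norm_self _).trans (hB _)).trans ?_
    rw [nsmul_eq_mul]
    calc _ ≤ (5 * δ⁻¹) ^ d * B := by
          gcongr
          refine (card_latticeCube_le (by positivity)).trans ?_
          have : 1 ≤ δ⁻¹ := (one_le_inv₀ hδ).mpr hδ1
          gcongr
          rw [div_eq_mul_inv]
          linarith
      _ = _ := by rw [mul_pow]; ring

end Riemann

/-! ### The middle block -/

section Middle

variable {d : ℕ}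

lemma stdAddChar_intCast_eq_e {q : ℕ} [NeZero q] (z : ℤ) :
    (ZMod.stdAddChar (z : ZMod q) : ℂ) = e (z / q) := by
  rw [ZMod.stdAddChar_coe, e]
  congr 1
  push_cast
  ring

/-- The Fourier side of the middle block. -/
noncomputable def middleFourier (Φ : 𝓢(EuclideanSpace ℝ (Fin d), ℂ))
    (ψ : 𝓢(EuclideanSpace ℝ (Fin d), ℝ)) (R D : ℝ) : 𝓢(EuclideanSpace ℝ (Fin d), ℂ) :=
  latticeFourier (latticeCube d (2 / (R / D)⁻¹)) (fun l => ψ ((R / D)⁻¹ • latticePoint l)) D Φ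

lemma datumMiddle_eq (φ : 𝓢(EuclideanSpace ℝ (Fin d), ℂ)) {ψ : 𝓢(EuclideanSpace ℝ (Fin d), ℝ)}
    (hψ : IsCutoff (1 / 20) ψ) {R D : ℝ} (hR : 0 < R) (hD : 0 < D) :
    datumMiddle φ ψ R D = 𝓕⁻ (middleFourier (𝓕 φ) ψ R D : EuclideanSpace ℝ (Fin d) → ℂ) := by
  rw [datumMiddle]
  congr 1
  ext ξ
  rw [middleFourier, latticeFourier_apply, tsum_eq_sum (s := latticeCube d (2 / (R / D)⁻¹))]
  · rfl
  · intro l hl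
    have : ψ ((R / D)⁻¹ • latticePoint l) = 0 := by
      refine hψ.support _ ?_
      by_contra h
      exact hl (mem_latticeCube_of_norm_le (by positivity) (not_lt.mp h))
    rw [this, Complex.ofReal_zero, zero_mul]

lemma integral_latticeSum (Φ : 𝓢(EuclideanSpace ℝ (Fin d), ℂ))
    (ψ : 𝓢(EuclideanSpace ℝ (Fin d), ℝ)) (δ t s : ℝ) (x w : EuclideanSpace ℝ (Fin d))
    (a : Fin d → ℤ → ℂ) :
    Integrable (fun η => Φ η * e (inner ℝ x η + t * ‖η‖ ^ 2) * latticeSum ψ δ (w + s • η) a) ∧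
    ∫ η, Φ η * e (inner ℝ x η + t * ‖η‖ ^ 2) * latticeSum ψ δ (w + s • η) a =
      ∑ l ∈ latticeCube d (2 / δ), ((ψ (δ • latticePoint l) : ℂ) * ∏ j, a j (l j)) *
        ∫ η, Φ η * e (inner ℝ x η + t * ‖η‖ ^ 2 + inner ℝ (w + s • η) (δ • latticePoint l)) := by
  have h1 : ∀ η, Φ η * e (inner ℝ x η + t * ‖η‖ ^ 2) * latticeSum ψ δ (w + s • η) a =
      ∑ l ∈ latticeCube d (2 / δ), ((ψ (δ • latticePoint l) : ℂ) * ∏ j, a j (l j)) *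
        (Φ η * e (inner ℝ x η + t * ‖η‖ ^ 2 + inner ℝ (w + s • η) (δ • latticePoint l))) := by
    intro η
    rw [latticeSum, Finset.mul_sum]
    refine Finset.sum_congr rfl fun l _ => ?_
    rw [e_add (inner ℝ x η + t * ‖η‖ ^ 2)]
    ring
  have hint (l : Fin d → ℤ) : Integrable fun η =>
      ((ψ (δ • latticePoint l) : ℂ) * ∏ j, a j (l j)) *
        (Φ η * e (inner ℝ x η + t * ‖η‖ ^ 2 + inner ℝ (w + s • η) (δ • latticePoint l))) :=
    (integrable_mul_phase (by fun_prop)).const_mul _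
  simp only [h1]
  refine ⟨integrable_finsetSum _ fun l _ => hint l, ?_⟩
  rw [integral_finsetSum _ fun l _ => hint l]
  exact Finset.sum_congr rfl fun l _ => integral_const_mul _ _

/-- At a rational time the wave packets of the middle block are superposed with the phases of a
quadratic exponential sum. -/
lemma phaseIntegral_middleFourier (Φ : 𝓢(EuclideanSpace ℝ (Fin d), ℂ))
    (ψ : 𝓢(EuclideanSpace ℝ (Fin d), ℝ)) {R D : ℝ} (hR : 0 < R) (hD : 0 < D) {q : ℕ} [NeZero q]
    {t : ℝ} {b : ℤ} (ht : t = b / (D ^ 2 * q)) (p : Fin d → ℤ) (x : EuclideanSpace ℝ (Fin d)) :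
    phaseIntegral t (middleFourier Φ ψ R D) x =
      ∫ η, Φ η * e (inner ℝ x η + t * ‖η‖ ^ 2) *
        latticeSum ψ (R / D)⁻¹ (R • (x - (D * q)⁻¹ • latticePoint p) + (2 * t * R) • η)
          (fun j l => ZMod.stdAddChar (((b : ℤ) : ZMod q) * (l : ZMod q) ^ 2 +
            ((p j : ℤ) : ZMod q) * (l : ZMod q))) := by
  have hq0 : (0 : ℝ) < q := by exact_mod_cast NeZero.pos q
  rw [(integral_latticeSum Φ ψ (R / D)⁻¹ t (2 * t * R) x
    (R • (x - (D * q)⁻¹ • latticePoint p)) _).2, middleFourier, phaseIntegral_latticeFourier]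
  refine Finset.sum_congr rfl fun l _ => ?_
  rw [mul_assoc]
  congr 1
  have hprod : ∏ j, (ZMod.stdAddChar (((b : ℤ) : ZMod q) * ((l j : ℤ) : ZMod q) ^ 2 +
      ((p j : ℤ) : ZMod q) * ((l j : ℤ) : ZMod q)) : ℂ) =
      e (b / q * ‖latticePoint l‖ ^ 2 + (q : ℝ)⁻¹ * inner ℝ (latticePoint p) (latticePoint l)) := by
    have h1 (j : Fin d) : (ZMod.stdAddChar (((b : ℤ) : ZMod q) * ((l j : ℤ) : ZMod q) ^ 2 +
        ((p j : ℤ) : ZMod q) * ((l j : ℤ) : ZMod q)) : ℂ) =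
        e (b / q * (l j : ℝ) ^ 2 + (q : ℝ)⁻¹ * (p j * l j)) := by
      have h2 := stdAddChar_intCast_eq_e (q := q) (b * l j ^ 2 + p j * l j)
      push_cast at h2
      rw [h2]
      congr 1
      ring
    simp only [h1]
    rw [← e_sum, Finset.sum_add_distrib, ← Finset.mul_sum, ← Finset.mul_sum, inner_latticePoint,
      EuclideanSpace.norm_sq_eq]
    congr 1
    push_cast
    simp [latticePoint]
  rw [hprod, ← integral_const_mul]
  refine integral_congr_ae (.of_forall fun η => ?_)
  simp only
  rw [mul_left_comm, ← e_add]
  congr 2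
  rw [norm_add_sq_real, norm_smul, Real.norm_of_nonneg hD.le, inner_add_right, inner_add_left,
    inner_smul_right, inner_smul_right, inner_smul_right, inner_smul_right, real_inner_smul_left,
    inner_sub_left, real_inner_smul_left, real_inner_smul_left, ht]
  field_simp
  ring

/-- Without the arithmetic factor, the sums over the lattice are in phase. -/
lemma norm_integral_latticeSum_bounds {Φ : 𝓢(EuclideanSpace ℝ (Fin d), ℂ)} (hΦ : IsBump Φ)
    {ψ : 𝓢(EuclideanSpace ℝ (Fin d), ℝ)} (hψ : IsCutoff (1 / 20) ψ) {δ t s : ℝ}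
    (ht : |t| ≤ 1) (hs : |s| ≤ 2) {x w : EuclideanSpace ℝ (Fin d)}
    (hx : ‖x‖ ≤ 1) (hw : ‖w‖ ≤ 1) :
    1 / 2 * (mass Φ * ∑ l ∈ latticeCube d (2 / δ), ψ (δ • latticePoint l)) ≤
      ‖∫ η, Φ η * e (inner ℝ x η + t * ‖η‖ ^ 2) * latticeSum ψ δ (w + s • η) 1‖ ∧
    ‖∫ η, Φ η * e (inner ℝ x η + t * ‖η‖ ^ 2) * latticeSum ψ δ (w + s • η) 1‖ ≤
      mass Φ * ∑ l ∈ latticeCube d (2 / δ), ψ (δ • latticePoint l) := by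
  have hE : ∫ η, Φ η * e (inner ℝ x η + t * ‖η‖ ^ 2) * latticeSum ψ δ (w + s • η) 1 =
      ∑ l ∈ latticeCube d (2 / δ), (ψ (δ • latticePoint l) : ℂ) * ∫ η, (‖Φ η‖ : ℂ) *
        e (inner ℝ x η + t * ‖η‖ ^ 2 + inner ℝ (w + s • η) (δ • latticePoint l)) := by
    rw [(integral_latticeSum Φ ψ δ t s x w 1).2]
    refine Finset.sum_congr rfl fun l _ => ?_
    simp only [Pi.one_apply, Finset.prod_const_one, mul_one]
    congr 1
    refine integral_congr_ae (.of_forall fun η => ?_)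
    simp only
    rw [← hΦ.eq_norm]
  rw [hE]
  constructor
  · refine le_trans ?_ (Complex.re_le_norm _)
    rw [Complex.re_sum, Finset.mul_sum, Finset.mul_sum]
    refine Finset.sum_le_sum fun l _ => ?_
    rw [Complex.re_ofReal_mul]
    by_cases h0 : ψ (δ • latticePoint l) = 0
    · simp [h0]
    have hl : ‖δ • latticePoint l‖ ≤ 1 / 20 := by
      by_contra h
      exact h0 (hψ.support _ (not_le.mp h))
    have := half_integral_le_re (μ := volume) (ρ := fun η => ‖Φ η‖) (θ := fun η => inner ℝ x η + t * ‖η‖ ^ 2 +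
      inner ℝ (w + s • η) (δ • latticePoint l)) (fun _ => norm_nonneg _)
      Φ.integrable.norm (Continuous.aestronglyMeasurable (by fun_prop)) fun η hη => ?_
    · have := mul_le_mul_of_nonneg_left this (hψ.nonneg (δ • latticePoint l))
      refine le_trans (le_of_eq ?_) this
      rw [mass]
      ring
    · have hη' := hΦ.support η (by simpa using hη)
      have h1 : |inner ℝ x η| ≤ 1 * (1 / 20) :=
        (abs_real_inner_le_norm _ _).trans (by gcongr)
      have h2 : |t * ‖η‖ ^ 2| ≤ 1 * (1 / 20) ^ 2 := by
        rw [abs_mul, abs_of_nonneg (sq_nonneg ‖η‖)]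
        gcongr
      have h3 : |inner ℝ (w + s • η) (δ • latticePoint l)| ≤ (1 + 2 * (1 / 20)) * (1 / 20) := by
        refine (abs_real_inner_le_norm _ _).trans ?_
        gcongr
        refine (norm_add_le _ _).trans ?_
        rw [norm_smul, Real.norm_eq_abs]
        gcongr
      refine (abs_add_three _ _ _).trans ?_
      linarith
  · refine (norm_sum_le _ _).trans ?_
    rw [Finset.mul_sum]
    refine Finset.sum_le_sum fun l _ => ?_
    rw [norm_mul, Complex.norm_real, Real.norm_of_nonneg (hψ.nonneg _), mul_comm]
    exact mul_le_mul_of_nonneg_right (norm_integral_phase_le _ fun _ => norm_nonneg _)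
      (hψ.nonneg _)

lemma IsCutoff.exists_ne_zero {r : ℝ} {ψ : 𝓢(EuclideanSpace ℝ (Fin d), ℝ)} (hψ : IsCutoff r ψ) :
    ∃ y, ψ y ≠ 0 := by
  by_contra! h0
  exact hψ.ne_zero (SchwartzMap.ext h0)

lemma IsCutoff.norm_le {r : ℝ} {ψ : 𝓢(EuclideanSpace ℝ (Fin d), ℝ)} (hψ : IsCutoff r ψ)
    {y : EuclideanSpace ℝ (Fin d)} (hy : ψ y ≠ 0) : ‖y‖ ≤ r := by
  by_contra h
  exact hy (hψ.support _ (not_le.mp h))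

/-- The size of the middle block near the points `p / (D q)`, when it has many more than `q`
frequencies in each direction. -/
lemma sameSize_phaseIntegral_middle {Φ : 𝓢(EuclideanSpace ℝ (Fin d), ℂ)} (hΦ : IsBump Φ)
    {ψ : 𝓢(EuclideanSpace ℝ (Fin d), ℝ)} (hψ : IsCutoff (1 / 20) ψ) :
    ∃ C₀ : ℝ, 1 ≤ C₀ ∧ ∃ K : ℝ, 0 < K ∧ ∀ {R D t : ℝ} {q : ℕ} [NeZero q] {b : ℤ} {p : Fin d → ℤ}
      {x : EuclideanSpace ℝ (Fin d)}, 1 ≤ R → 0 < D → C₀ * (D * q) ≤ R → Odd q →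
      IsUnit (b : ZMod q) → t = b / (D ^ 2 * q) → |t| ≤ 1 / R →
      ‖x - (D * q)⁻¹ • latticePoint p‖ ≤ 1 / R → ‖x‖ ≤ 1 →
      SameSize K ‖phaseIntegral t (middleFourier Φ ψ R D) x‖ (((√q)⁻¹ * (R / D)) ^ d) := by
  have hI := mass_pos hΦ.ne_zero
  obtain ⟨M, hM, hbound⟩ := exists_bound_latticeSum hψ
  obtain ⟨δ₀, hδ₀, L, hL, hriem⟩ := sameSize_riemann ψ.continuous hψ.nonneg hψ.exists_ne_zero
    fun y => hψ.norm_le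
  -- the third entry of `C₀` makes the error term at most half as large as the main term
  set C₀ := max 1 (max δ₀⁻¹ (4 * M * L)) with hC₀
  have hC1 : 1 ≤ C₀ := le_max_left _ _
  have hC0 : 0 < C₀ := by linarith
  have hCδ : δ₀⁻¹ ≤ C₀ := (le_max_left _ _).trans (le_max_right _ _)
  have hCM : 4 * M * L ≤ C₀ := (le_max_right _ _).trans (le_max_right _ _)
  refine ⟨C₀, hC1, max (mass Φ * (L + M)) (mass Φ * (1 / 4 * L⁻¹))⁻¹, by positivity, ?_⟩
  intro R D t q _ b p x hR hD hRC hq hb ht htR hxp hx1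
  have hR0 : 0 < R := by linarith
  have hq0 : (0 : ℝ) < q := by exact_mod_cast NeZero.pos q
  have hq1 : (1 : ℝ) ≤ q := by exact_mod_cast NeZero.pos q
  have hsq : 0 < √(q : ℝ) := Real.sqrt_pos.mpr hq0
  set δ := (R / D)⁻¹ with hδdef
  have hδ : 0 < δ := by positivity
  have hinv : R / D = δ⁻¹ := by rw [hδdef, inv_inv]
  have hqδ : q * δ ≤ C₀⁻¹ := by
    rw [hδdef, inv_div, ← one_div, le_div_iff₀ hC0, mul_div_assoc', div_mul_eq_mul_div,
      div_le_one hR0]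
    linarith
  have hC1' : C₀⁻¹ ≤ 1 := inv_le_one_of_one_le₀ hC1
  have hδq : δ ≤ q * δ := le_mul_of_one_le_left hδ.le hq1
  have hδ1 : δ ≤ 1 := by linarith
  have hδδ : δ ≤ δ₀ := by
    refine (hδq.trans hqδ).trans ?_
    rw [inv_le_comm₀ hC0 hδ₀]
    exact hCδ
  have hsum := hriem hδ hδδ
  rw [phaseIntegral_middleFourier Φ ψ hR0 hD ht p x, hinv, inv_inv]
  set a : Fin d → ℤ → ℂ := fun j l => ZMod.stdAddChar (((b : ℤ) : ZMod q) * (l : ZMod q) ^ 2 +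
            ((p j : ℤ) : ZMod q) * (l : ZMod q)) with ha
  set w := R • (x - (D * q)⁻¹ • latticePoint p) with hw
  have hw1 : ‖w‖ ≤ 1 := by
    rw [hw, norm_smul, Real.norm_of_nonneg hR0.le]
    calc _ ≤ R * (1 / R) := by gcongr
      _ = 1 := by field_simp
  have hs2 : |2 * t * R| ≤ 2 := by
    rw [abs_mul, abs_mul, abs_of_pos hR0, abs_two]
    calc 2 * |t| * R ≤ 2 * (1 / R) * R := by gcongr
      _ = 2 := by field_simp
  have ht1 : |t| ≤ 1 := htR.trans ((div_le_one hR0).mpr hR)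
  set γ : ℂ := ∏ j, (q : ℂ)⁻¹ * quadGauss (b : ZMod q) (p j : ZMod q) with hγ
  have hγn : ‖γ‖ = (√q)⁻¹ ^ d := by
    rw [hγ, norm_prod, Finset.prod_congr rfl fun j _ => norm_inv_mul_quadGauss hq hb _,
      Finset.prod_const, Finset.card_univ, Fintype.card_fin]
  obtain ⟨hlow, hup⟩ := norm_integral_latticeSum_bounds hΦ hψ (δ := δ) ht1 hs2 hx1 hw1
  set S := ∑ l ∈ latticeCube d (2 / δ), ψ (δ • latticePoint l) with hS
  set J := ∫ η, Φ η * e (inner ℝ x η + t * ‖η‖ ^ 2) * latticeSum ψ δ (w + (2 * t * R) • η) 1 with hJ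
  set P := (√(q : ℝ))⁻¹ ^ d * δ⁻¹ ^ d with hP
  have hP0 : 0 < P := by positivity
  -- the error of the lattice sum estimate, integrated over `η`
  have herr : ‖(∫ η, Φ η * e (inner ℝ x η + t * ‖η‖ ^ 2) *
      latticeSum ψ δ (w + (2 * t * R) • η) a) - γ * J‖ ≤ mass Φ * (P * (M * (q * δ) ^ 2)) := by
    rw [hJ, ← integral_const_mul, ← integral_sub (integral_latticeSum Φ ψ δ t _ x w a).1
      ((integral_latticeSum Φ ψ δ t _ x w 1).1.const_mul _), mass, ← integral_mul_const]
    refine norm_integral_le_of_norm_le (Φ.integrable.norm.mul_const _) (.of_forall fun η => ?_)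
    have h1 : Φ η * e (inner ℝ x η + t * ‖η‖ ^ 2) * latticeSum ψ δ (w + (2 * t * R) • η) a -
        γ * (Φ η * e (inner ℝ x η + t * ‖η‖ ^ 2) * latticeSum ψ δ (w + (2 * t * R) • η) 1) =
        Φ η * e (inner ℝ x η + t * ‖η‖ ^ 2) * (latticeSum ψ δ (w + (2 * t * R) • η) a -
          γ * latticeSum ψ δ (w + (2 * t * R) • η) 1) := by ring
    rw [h1, norm_mul, norm_mul, norm_e, mul_one]
    by_cases h0 : Φ η = 0
    · simp [h0]
    gcongr
    rw [hP, ← mul_pow]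
    refine hbound hδ hδ1 ?_ hq (hqδ.trans hC1') hb _
    refine (norm_add_le _ _).trans ?_
    rw [norm_smul (2 * t * R), Real.norm_eq_abs]
    have h2 := hΦ.support η h0
    have h3 : |2 * t * R| * ‖η‖ ≤ 2 * (1 / 20) := by gcongr
    linarith
  have hγJ : ‖γ * J‖ = (√(q : ℝ))⁻¹ ^ d * ‖J‖ := by rw [norm_mul, hγn]
  have hsq0 : 0 < (√(q : ℝ))⁻¹ ^ d := by positivity
  have hPle : (√(q : ℝ))⁻¹ ^ d * (L⁻¹ * δ⁻¹ ^ d) ≤ (√(q : ℝ))⁻¹ ^ d * S :=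
    mul_le_mul_of_nonneg_left hsum.1 hsq0.le
  have hPge : (√(q : ℝ))⁻¹ ^ d * S ≤ (√(q : ℝ))⁻¹ ^ d * (L * δ⁻¹ ^ d) :=
    mul_le_mul_of_nonneg_left hsum.2 hsq0.le
  have hJlow := mul_le_mul_of_nonneg_left hlow hsq0.le
  have hJup := mul_le_mul_of_nonneg_left hup hsq0.le
  have hqδ2 : (q * δ) ^ 2 ≤ C₀⁻¹ := by
    calc (q * δ) ^ 2 ≤ C₀⁻¹ ^ 2 := by gcongr
      _ ≤ C₀⁻¹ := by
        rw [sq]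
        exact mul_le_of_le_one_left (by positivity) hC1'
  have hsmall : M * (q * δ) ^ 2 ≤ 1 / 4 * L⁻¹ := by
    calc M * (q * δ) ^ 2 ≤ M * (4 * M * L)⁻¹ := by
          gcongr
          exact hqδ2.trans (inv_anti₀ (by positivity) hCM)
      _ = 1 / 4 * L⁻¹ := by field_simp
  have hsmall' : M * (q * δ) ^ 2 ≤ M := by
    have : (q * δ) ^ 2 ≤ 1 := hqδ2.trans hC1'
    nlinarith
  rw [mul_pow]
  have hmP : 0 < mass Φ * P := by positivity
  refine sameSize_of_between (by positivity) hP0.le ?_ ?_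
  · have h1 := norm_sub_norm_le (γ * J) (γ * J - ∫ η, Φ η * e (inner ℝ x η + t * ‖η‖ ^ 2) *
      latticeSum ψ δ (w + (2 * t * R) • η) a)
    rw [sub_sub_cancel, norm_sub_rev (γ * J), hγJ] at h1
    have h2 : mass Φ * ((√(q : ℝ))⁻¹ ^ d * (L⁻¹ * δ⁻¹ ^ d)) ≤ mass Φ * ((√(q : ℝ))⁻¹ ^ d * S) :=
      mul_le_mul_of_nonneg_left hPle hI.le
    have h3 : mass Φ * (P * (M * (q * δ) ^ 2)) ≤ mass Φ * (P * (1 / 4 * L⁻¹)) := by gcongr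
    have h4 : mass Φ * ((√(q : ℝ))⁻¹ ^ d * (L⁻¹ * δ⁻¹ ^ d)) = mass Φ * P * L⁻¹ := by
      rw [hP]
      ring
    linarith
  · have h1 := norm_add_le ((∫ η, Φ η * e (inner ℝ x η + t * ‖η‖ ^ 2) *
      latticeSum ψ δ (w + (2 * t * R) • η) a) - γ * J) (γ * J)
    rw [sub_add_cancel, hγJ] at h1
    have h2 : mass Φ * ((√(q : ℝ))⁻¹ ^ d * S) ≤ mass Φ * ((√(q : ℝ))⁻¹ ^ d * (L * δ⁻¹ ^ d)) :=
      mul_le_mul_of_nonneg_left hPge hI.le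
    have h3 : mass Φ * (P * (M * (q * δ) ^ 2)) ≤ mass Φ * (P * M) := by gcongr
    have h4 : mass Φ * ((√(q : ℝ))⁻¹ ^ d * (L * δ⁻¹ ^ d)) = mass Φ * P * L := by
      rw [hP]
      ring
    linarith

lemma latticeCube_dim_zero (s : ℝ) : latticeCube 0 s = {0} := by
  rw [Finset.eq_singleton_iff_unique_mem]
  exact ⟨mem_latticeCube.mpr fun i => i.elim0, fun l _ => Subsingleton.elim _ _⟩

/-- In dimension zero the middle block is a single bump, and nothing depends on the parameters. -/
lemma middle_dim_zero {Φ : 𝓢(EuclideanSpace ℝ (Fin 0), ℂ)} (hΦ : IsBump Φ)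
    (ψ : 𝓢(EuclideanSpace ℝ (Fin 0), ℝ)) (R D t : ℝ) (x : EuclideanSpace ℝ (Fin 0)) :
    phaseIntegral t (middleFourier Φ ψ R D) x = (ψ 0 * mass Φ : ℝ) := by
  rw [middleFourier, phaseIntegral_latticeFourier, latticeCube_dim_zero, Finset.sum_singleton, mass,
    Complex.ofReal_mul, ← integral_complex_ofReal]
  congr 1
  · rw [Subsingleton.elim ((R / D)⁻¹ • latticePoint 0) 0]
  · refine integral_congr_ae (.of_forall fun η => ?_)
    simp only
    rw [← hΦ.eq_norm, Subsingleton.elim (η + D • latticePoint 0) 0]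
    simp [e]

lemma normSq_middle_dim_zero {Φ : 𝓢(EuclideanSpace ℝ (Fin 0), ℂ)}
    (ψ : 𝓢(EuclideanSpace ℝ (Fin 0), ℝ)) (R D : ℝ) :
    normSq (middleFourier Φ ψ R D : _ → ℂ) = ψ 0 ^ 2 * normSq (Φ : _ → ℂ) := by
  simp only [normSq]
  rw [← integral_const_mul]
  refine integral_congr_ae (.of_forall fun η => ?_)
  simp only
  rw [middleFourier, latticeFourier_apply, latticeCube_dim_zero, Finset.sum_singleton,
    Subsingleton.elim ((R / D)⁻¹ • latticePoint 0) 0, Subsingleton.elim (η - D • latticePoint 0) η,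
    norm_mul, mul_pow, Complex.norm_real, Real.norm_eq_abs, sq_abs]

/-- The size of the middle block relative to its norm. -/
lemma sameSize_middle {Φ : 𝓢(EuclideanSpace ℝ (Fin d), ℂ)} (hΦ : IsBump Φ)
    {ψ : 𝓢(EuclideanSpace ℝ (Fin d), ℝ)} (hψ : IsCutoff (1 / 20) ψ) :
    ∃ C₀ : ℝ, 1 ≤ C₀ ∧ ∃ K : ℝ, 0 < K ∧ ∀ {R D Q t : ℝ} {q : ℕ} {b : ℤ} {p : Fin d → ℤ}
      {x : EuclideanSpace ℝ (Fin d)}, 1 ≤ R → 1 ≤ D → (0 < d → C₀ * (D * Q) ≤ R) → Odd q →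
      Q / 2 ≤ q → q < Q →
      Int.gcd b q = 1 → t = b / (D ^ 2 * q) → |t| ≤ 1 / R →
      ‖x - (D * q)⁻¹ • latticePoint p‖ ≤ 1 / R → ‖x‖ ≤ 1 →
      SameSize K (‖phaseIntegral t (middleFourier Φ ψ R D) x‖ /
        √(normSq (middleFourier Φ ψ R D : _ → ℂ))) ((R / (D * Q)) ^ ((d : ℝ) / 2)) := by
  have hI := mass_pos hΦ.ne_zero
  have hN := normSq_pos hΦ.ne_zero
  rcases Nat.eq_zero_or_pos d with rfl | hd
  · obtain ⟨y, hy⟩ := hψ.exists_ne_zero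
    rw [Subsingleton.elim y 0] at hy
    have hψ0 : 0 < ψ 0 := lt_of_le_of_ne (hψ.nonneg 0) hy.symm
    set k := ψ 0 * mass Φ / √(ψ 0 ^ 2 * normSq (Φ : _ → ℂ)) with hk
    have hk0 : 0 < k := by positivity
    refine ⟨1, le_refl _, max k k⁻¹, by positivity, ?_⟩
    intro R D Q t q b p x _ _ _ _ _ _ _ _ _ _ _
    rw [middle_dim_zero hΦ, normSq_middle_dim_zero, Complex.norm_real,
      Real.norm_of_nonneg (by positivity), ← hk]
    simpa using sameSize_const_mul hk0 zero_le_one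
  · obtain ⟨C₁, hC₁, K, hK, h1⟩ := sameSize_phaseIntegral_middle hΦ hψ
    obtain ⟨δ₀, hδ₀, L, hL, h2⟩ := sameSize_riemann (g := fun y => ψ y ^ 2) (ψ.continuous.pow 2)
      (fun y => sq_nonneg _) (by
        obtain ⟨y, hy⟩ := hψ.exists_ne_zero
        exact ⟨y, pow_ne_zero 2 hy⟩)
      fun y hy => hψ.norm_le (pow_ne_zero_iff two_ne_zero |>.mp hy)
    refine ⟨max C₁ δ₀⁻¹, hC₁.trans (le_max_left _ _),
      K * √(max (normSq Φ) (normSq Φ)⁻¹ * L) * √(2 ^ d), by positivity, ?_⟩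
    intro R D Q t q b p x hR hD hRC hq hqQ hqQ' hb ht htR hxp hx1
    have hR0 : 0 < R := by linarith
    have hD0 : 0 < D := by linarith
    have : NeZero q := ⟨hq.pos.ne'⟩
    have hq0 : (0 : ℝ) < q := by exact_mod_cast hq.pos
    have hq1 : (1 : ℝ) ≤ q := by exact_mod_cast hq.pos
    have hQ0 : 0 < Q := hq0.trans hqQ'
    have hunit : IsUnit (b : ZMod q) := by
      rw [ZMod.coe_int_isUnit_iff_isCoprime, Int.isCoprime_iff_gcd_eq_one, Int.gcd_comm]
      exact hb
    have hRC := hRC hd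
    have hC1 : C₁ * (D * q) ≤ R := by
      refine le_trans ?_ hRC
      gcongr
      exact le_max_left _ _
    have hδδ : (R / D)⁻¹ ≤ δ₀ := by
      rw [inv_le_comm₀ (by positivity) hδ₀, le_div_iff₀ hD0]
      refine le_trans ?_ hRC
      refine mul_le_mul (le_max_right _ _) ?_ hD0.le (by positivity)
      exact le_mul_of_one_le_right hD0.le (by linarith)
    have hE := h1 hR hD0 hC1 hq hunit ht htR hxp hx1
    have hS := h2 (by positivity) hδδ
    rw [inv_inv] at hS
    have hnorm : SameSize (max (normSq Φ) (normSq Φ)⁻¹ * L)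
        (normSq (middleFourier Φ ψ R D : _ → ℂ)) ((R / D) ^ d) := by
      rw [middleFourier, normSq_latticeFourier _ (fun _ => hψ.nonneg _) hD hΦ,
        mul_comm _ (normSq (Φ : _ → ℂ))]
      refine SameSize.trans (by positivity) (sameSize_const_mul hN ?_) hS
      exact Finset.sum_nonneg fun _ _ => sq_nonneg _
    refine SameSize.trans (by positivity) (hE.div_sqrt hK (by positivity) (by positivity)
      (by positivity) hnorm) ?_
    have hX : ((√(q : ℝ))⁻¹ * (R / D)) ^ d / √((R / D) ^ d) = √((R / D / q) ^ d) := by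
      rw [mul_pow, mul_div_assoc, Real.div_sqrt, div_eq_mul_inv (R / D) (q : ℝ), mul_pow,
        Real.sqrt_mul (by positivity), mul_comm]
      congr 1
      have hpow : ((q : ℝ)⁻¹) ^ d = ((√(q : ℝ))⁻¹ ^ d) ^ 2 := by
        rw [← pow_mul, mul_comm d 2, pow_mul, inv_pow (√(q : ℝ)) 2, Real.sq_sqrt hq0.le]
      rw [hpow, Real.sqrt_sq (by positivity)]
    have hY : (R / (D * Q)) ^ ((d : ℝ) / 2) = √((R / D / Q) ^ d) := by
      rw [rpow_half_natCast (by positivity), Real.div_sqrt, div_div]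
    rw [hX, hY]
    refine SameSize.sqrt (by positivity) ⟨?_, ?_⟩
    · rw [← inv_pow, ← mul_pow]
      gcongr
      rw [inv_mul_le_iff₀ two_pos]
      have : R / D / Q ≤ R / D / q := by gcongr
      have : 0 ≤ R / D / q := by positivity
      linarith
    · rw [← mul_pow]
      gcongr
      rw [div_le_iff₀ hq0, mul_assoc, div_mul_eq_mul_div, mul_div_assoc']
      rw [le_div_iff₀ hQ0]
      have : 0 ≤ R / D := by positivity
      nlinarith

end Middle

/-! ### Assembling the blocks -/

lemma datumFirst_eq (φ : 𝓢(ℝ, ℂ)) {R : ℝ} (hR : 0 < R) :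
    datumFirst φ R = 𝓕⁻ (firstFourier (𝓕 φ) hR : ℝ → ℂ) := rfl

/-- A point of the slab that lies at distance between `1 / 10` and `1` from the hyperplane
`x₁ = 0` belongs to a time comparable to `1 / R`. -/
lemma sameSize_time {R t x : ℝ} (hR : 400 ≤ R) (h : |x + 2 * R * t| ≤ 1 / √R) (h1 : 1 / 10 ≤ |x|)
    (h2 : |x| ≤ 1) : SameSize 40 |t| (1 / R) := by
  have hR0 : 0 < R := by linarith
  have hs : 1 / √R ≤ 1 / 20 := by
    have : 20 ≤ √R := Real.le_sqrt_of_sq_le (by linarith)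
    gcongr
  have h3 : |2 * R * t| = 2 * (R * |t|) := by
    rw [abs_mul, abs_mul, abs_two, abs_of_pos hR0, mul_assoc]
  have h4 := abs_sub_abs_le_abs_sub x (-(2 * R * t))
  have h5 := abs_sub_abs_le_abs_sub (-(2 * R * t)) x
  rw [abs_sub_comm (-(2 * R * t))] at h5
  rw [abs_neg, sub_neg_eq_add, h3] at h4 h5
  constructor
  · rw [mul_one_div, div_le_iff₀ hR0]
    linarith
  · rw [mul_one_div, le_div_iff₀ hR0]
    linarith

end TalbotDatum

open TalbotDatum in
theorem mainTheorem5 (n m : ℕ) (_hm : 1 ≤ m) (hmn : m < n) :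
    ∃ c₀ : ℝ, 0 < c₀ ∧
    ∀ (c : ℝ), 0 < c → c ≤ c₀ →
    ∀ (φ : 𝓢(ℝ, ℂ)) (φ₁ : 𝓢(EuclideanSpace ℝ (Fin (n - m - 1)), ℂ))
      (φ₂ : 𝓢(EuclideanSpace ℝ (Fin m), ℂ)) (ψ : 𝓢(EuclideanSpace ℝ (Fin (n - m - 1)), ℝ)),
    TalbotDatum.IsFourierBump c₀ φ → TalbotDatum.IsFourierBump c₀ φ₁ →
    TalbotDatum.IsFourierBump c₀ φ₂ → TalbotDatum.IsCutoff c₀ ψ →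
    ∃ C₀ : ℝ, 0 < C₀ ∧ ∃ C : ℝ, 0 < C ∧
    ∀ (R D₁ D₂ Q : ℝ), C₀ ≤ R → 1 ≤ D₁ → 1 ≤ D₂ → D₂ ≤ √R →
      (m + 1 < n → C₀ * (D₁ * Q) ≤ R) →
    ∀ (q : ℕ), Odd q → Q / 2 ≤ q → (q : ℝ) < Q →
    ∀ (p : Fin n → ℤ), Int.gcd (TalbotDatum.firstPart hmn p) q = 1 →
    ∀ x ∈ TalbotDatum.slab hmn R D₁ D₂ p q,
      (|TalbotDatum.time hmn D₁ p q| ≤ 1 / R →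
        ‖WithLp.toLp 2 (TalbotDatum.middlePart hmn x.ofLp)‖ ≤ 1 →
        ‖WithLp.toLp 2 (TalbotDatum.lastPart hmn x.ofLp)‖ ≤ 1 →
        C⁻¹ * (R ^ (1 / 4 : ℝ) * (R / (D₁ * Q)) ^ (((n : ℝ) - m - 1) / 2) *
            (√R / D₂) ^ ((m : ℝ) / 2)) ≤
          ‖TalbotDatum.evolution (TalbotDatum.time hmn D₁ p q)
              (TalbotDatum.datum hmn φ φ₁ φ₂ ψ c R D₁ D₂) x‖ /
            TalbotDatum.normL2 (TalbotDatum.datum hmn φ φ₁ φ₂ ψ c R D₁ D₂) ∧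
        ‖TalbotDatum.evolution (TalbotDatum.time hmn D₁ p q)
              (TalbotDatum.datum hmn φ φ₁ φ₂ ψ c R D₁ D₂) x‖ /
            TalbotDatum.normL2 (TalbotDatum.datum hmn φ φ₁ φ₂ ψ c R D₁ D₂) ≤
          C * (R ^ (1 / 4 : ℝ) * (R / (D₁ * Q)) ^ (((n : ℝ) - m - 1) / 2) *
            (√R / D₂) ^ ((m : ℝ) / 2))) ∧
      (1 / 10 ≤ |TalbotDatum.firstPart hmn x.ofLp| → |TalbotDatum.firstPart hmn x.ofLp| ≤ 1 →
        C⁻¹ * (1 / R) ≤ |TalbotDatum.time hmn D₁ p q| ∧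
        |TalbotDatum.time hmn D₁ p q| ≤ C * (1 / R)) := by
  -- with bumps of radius `1 / 20` all phases that should be negligible stay below `1 / 6`
  refine ⟨1 / 20, by norm_num, fun c hc hc' φ φ₁ φ₂ ψ hφ hφ₁ hφ₂ hψ => ?_⟩
  obtain ⟨K₁, hK₁, h₁⟩ := sameSize_first hφ.isBump
  obtain ⟨C₀, hC₀, K₂, hK₂, h₂⟩ := sameSize_middle hφ₁.isBump hψ
  obtain ⟨K₃, hK₃, h₃⟩ := sameSize_last hφ₂.isBump hc hc'
  -- for `R ≥ 400` the slab is thin compared with the lower bound `1 / 10` for `|x₁|`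
  refine ⟨max 400 C₀, by positivity, max 40 (K₁ * K₂ * K₃), by positivity, ?_⟩
  intro R D₁ D₂ Q hR hD₁ hD₂ hDR hRQ q hq hqQ hqQ' p hp x hx
  have hR400 : 400 ≤ R := (le_max_left _ _).trans hR
  have hR0 : 0 < R := by linarith
  have hR1 : 1 ≤ R := by linarith
  have hD₁0 : 0 < D₁ := by linarith
  have hD₂0 : 0 < D₂ := by linarith
  have hq0 : (0 : ℝ) < q := by exact_mod_cast hq.pos
  have hQ0 : 0 < Q := hq0.trans hqQ'
  obtain ⟨hx₁, hx₂, hx₃⟩ := hx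
  set t := time hmn D₁ p q with ht
  have hx₁ : |firstPart hmn x.ofLp + 2 * R * t| ≤ 1 / √R := by
    refine le_trans (le_of_eq ?_) hx₁
    rw [ht, time]
    congr 1
    field_simp
    ring
  refine ⟨fun htR hx' hx'' => ?_, fun h1 h2 => ?_⟩
  · have hfirst := h₁ hR1 htR hx₁
    have hmiddle := h₂ (b := firstPart hmn p) hR1 hD₁ (fun hd => ?_) hq hqQ hqQ' hp ht htR hx₂ hx'
    · have hlast := h₃ hR1 hD₂ hDR htR hx₃ hx''
      have hprod := ((hfirst.mul hK₁ hK₂ (by positivity) (by positivity) hmiddle).mul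
        (by positivity) hK₃ (by positivity) (by positivity) hlast).mono (by positivity)
        (le_max_right 40 _) (by positivity)
      have hdim : ((n - m - 1 : ℕ) : ℝ) = (n : ℝ) - m - 1 := by
        rw [Nat.cast_sub (by omega), Nat.cast_sub hmn.le, Nat.cast_one]
      have hdatum : datum hmn φ φ₁ φ₂ ψ c R D₁ D₂ = tensor hmn
          (𝓕⁻ (firstFourier (𝓕 φ) (one_pos.trans_le hR1) : ℝ → ℂ))
          (𝓕⁻ (middleFourier (𝓕 φ₁) ψ R D₁ : _ → ℂ)) (𝓕⁻ (lastFourier (𝓕 φ₂) c R D₂ : _ → ℂ)) := by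
        rw [← datumFirst_eq, ← datumMiddle_eq φ₁ hψ hR0 hD₁0, ← datumLast_eq]
        rfl
      rw [hdim] at hprod
      rw [hdatum, evolution_tensor, normL2_tensor, tensor, norm_mul, norm_mul]
      rwa [mul_div_mul_comm, mul_div_mul_comm]
    · refine le_trans ?_ (hRQ (by omega))
      gcongr
      exact le_max_right _ _
  · exact (sameSize_time hR400 hx₁ h1 h2).mono (by norm_num) (le_max_left _ _) (by positivity)
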